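/- \textbf{Theorem (Cuntz--Krieger uniqueness theorem).} Let $E=(E^0,E^1,d,r)$ be a topological graph: $E^0,E^1$ are locally compact Hausdorff spaces, $d\colon E^1\to E^0$ is a local homeomorphism and $r\colon E^1\to E^0$ is continuous. Let $$C_d(E^1)=\Big\{\xi\in C(E^1)\ \Big|\ v\mapsto \sum_{e\in d^{-1}(v)}|\xi(e)|^2 \text{ belongs to } C_0(E^0)\Big\}$$ be the Hilbert $C_0(E^0)$-module with $\langle\xi,\eta\rangle(v)=\sum_{e\in d^{-1}(v)}\overline{\xi(e)}\eta(e)$, $(\xi f)(e)=\xi(e)f(d(e))$ and $\|\xi\|=\|\langle\xi,\xi\rangle\|^{1/2}$, and with left action $(\pi_r(f)\xi)(e)=f(r(e))\xi(e)$ of $C_0(E^0)$. Let $\mathcal K(C_d(E^1))$ be the closed linear span of the operators $\theta_{\xi,\eta}\colon\zeta\mapsto\xi\langle\eta,\zeta\rangle$. Put $E^0_{\rm sce}=E^0\setminus\overline{r(E^1)}$, let $E^0_{\rm fin}$ be the set of $v\in E^0$ that have a neighbourhood $V$ with $r^{-1}(V)$ compact, and let $E^0_{\rm rg}=E^0_{\rm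 fin}\setminus\overline{E^0_{\rm sce}}$. A Toeplitz $E$-pair on a $C^*$-algebra $A$ is a pair $T=(T^0,T^1)$ of a $*$-homomorphism $T^0\colon C_0(E^0)\to A$ and a linear map $T^1\colon C_d(E^1)\to A$ with $T^1(\xi)^*T^1(\eta)=T^0(\langle\xi,\eta\rangle)$ and $T^0(f)T^1(\xi)=T^1(\pi_r(f)\xi)$ for all $f\in C_0(E^0)$ and $\xi,\eta\in C_d(E^1)$. It induces a unique continuous linear map $\Phi^1\colon\mathcal K(C_d(E^1))\to A$ with $\Phi^1(\theta_{\xi,\eta})=T^1(\xi)T^1(\eta)^*$. It is a Cuntz--Krieger $E$-pair if $T^0(f)=\Phi^1(\pi_r(f))$ for all $f\in C_0(E^0_{\rm rg})$ (such $\pi_r(f)$ lie in $\mathcal K(C_d(E^1))$), and it is injective if $T^0$ is injective. Let $C^*(T)\subset A$ be the $C^*$-subalgebra generated by $T^0(C_0(E^0))\cup T^1(C_d(E^1))$, let $\mathcal O(E)$ be the universal $C^*$-algebra generated by a Cuntz--Krieger $E$-pair $t=(t^0,t^1)$, and for a Cuntz--Krieger $E$-pair $T$ let $\rho_T\colon\mathcal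 O(E)\to C^*(T)$ be the unique $*$-homomorphism with $\rho_T\circ t^i=T^i$ for $i=0,1$. A loop is a sequence $(e_n,\dots,e_1)$ of edges, $n\ge1$, with $d(e_{k+1})=r(e_k)$ for $1\le k\le n-1$ and $r(e_n)=d(e_1)$; this last vertex is its base point. The loop is without entrances if $r^{-1}(r(e_k))=\{e_k\}$ for $k=1,\dots,n$. Suppose that $E$ is topologically free, i.e. the set of base points of loops without entrances has empty interior in $E^0$. Then for every injective Cuntz--Krieger $E$-pair $T$, the map $\rho_T\colon\mathcal O(E)\to C^*(T)$ is an isomorphism. -/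

import Mathlib

open scoped ENNReal Topology ZeroAtInfty BoundedContinuousFunction ComplexConjugate

universe u v

/-- A topological graph: a local homeomorphism `d` (domain) and a continuous map `r` (range) from
the space of edges `E1` to the space of vertices `E0`.  Both spaces are locally compact Hausdorff;
these properties are carried as type class arguments. -/
structure TopologicalGraph (E0 E1 : Type u) [TopologicalSpace E0] [TopologicalSpace E1] where
  /-- the domain map -/
  d : E1 → E0
  /-- the range map -/
  r : E1 → E0
  isLocalHomeomorph_d : IsLocalHomeomorph d
  continuous_r : Continuous r

namespace TopologicalGraph

noncomputable section

variable {E0 E1 : Type u} [TopologicalSpace E0] [TopologicalSpace E1]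

section HilbertModule

variable (E : TopologicalGraph E0 E1)

/-- The fibre `d⁻¹(v)` of the domain map. -/
abbrev Fib (v : E0) : Type u := ↥(E.d ⁻¹' {v})

/-- The function `v ↦ ∑_{e ∈ d⁻¹(v)} f(e)` is everywhere finite, continuous, and vanishes at
infinity. -/
def HasC0FibreSum (f : E1 → ℝ) : Prop :=
  ∃ h : C₀(E0, ℝ), ∀ v, HasSum (fun e : E.Fib v => f e) (h v)

theorem lowerSemicontinuous_fibreSum [T2Space E1] {g : E1 → ℝ} (hg : Continuous g)
    (h0 : ∀ e, 0 ≤ g e) (hs : ∀ v, Summable fun e : E.Fib v => g e) :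
    LowerSemicontinuous fun v => ∑' e : E.Fib v, g e := by
  classical
  intro v y hy
  obtain ⟨s, hys⟩ : ∃ s : Finset (E.Fib v), y < ∑ e ∈ s, g e :=
    (((hs v).hasSum).eventually (lt_mem_nhds hy)).exists
  obtain ⟨U, hU, hdisj⟩ := (s.image (fun e : E.Fib v => (e : E1))).finite_toSet.t2_separation
  choose φ hφ hφd using fun e : E1 => E.isLocalHomeomorph_d e
  have hdφ : ∀ e x : E1, E.d x = φ e x := fun e x => congrFun (hφd e) x
  have htgt : ∀ e : E.Fib v, v ∈ (φ e).target := fun e => by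
    have h1 := (φ (e : E1)).map_source (hφ e)
    rwa [← hdφ, show E.d e = v from e.2] at h1
  have hsec : ∀ e : E.Fib v, (φ e).symm v = e := fun e => by
    have h1 := (φ (e : E1)).left_inv (hφ e)
    rwa [← hdφ, show E.d e = v from e.2] at h1
  have hcont : ∀ e : E.Fib v, ContinuousAt (φ e).symm v := fun e =>
    (φ (e : E1)).continuousAt_symm (htgt e)
  have hc : ContinuousAt (fun w => ∑ e ∈ s, g ((φ (e : E1)).symm w)) v := by
    refine tendsto_finsetSum _ fun e _ => ?_
    exact (hg.continuousAt.comp (hcont e))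
  have hv : y < (fun w => ∑ e ∈ s, g ((φ (e : E1)).symm w)) v := by
    simpa [hsec] using hys
  have e1 := hc.eventually (lt_mem_nhds hv)
  have e2 : ∀ᶠ w in 𝓝 v, ∀ e ∈ s, (φ (e : E1)).symm w ∈ U e ∧ w ∈ (φ (e : E1)).target := by
    rw [Filter.eventually_all_finset]
    intro e _
    refine ((hcont e).eventually ?_).and ((φ (e : E1)).open_target.mem_nhds (htgt e))
    rw [hsec]
    exact (hU e).2.mem_nhds (hU e).1
  filter_upwards [e1, e2] with w hw1 hw2
  refine lt_of_lt_of_le hw1 ?_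
  let σ : s → E.Fib w := fun e => ⟨(φ ((e : E.Fib v) : E1)).symm w, by
    have h1 := (φ ((e : E.Fib v) : E1)).right_inv (hw2 e e.2).2
    rw [← hdφ] at h1
    exact h1⟩
  have hσ : Function.Injective σ := by
    intro a b hab
    by_contra hne
    have h1 : ((a : E.Fib v) : E1) ≠ ((b : E.Fib v) : E1) := fun h =>
      hne (Subtype.ext (Subtype.ext h))
    have h2 := hdisj (Finset.mem_coe.2 (Finset.mem_image_of_mem _ a.2))
      (Finset.mem_coe.2 (Finset.mem_image_of_mem _ b.2)) h1
    have h3 : (σ a : E1) = σ b := congrArg Subtype.val hab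
    refine Set.disjoint_left.1 h2 (hw2 a a.2).1 ?_
    have h4 := (hw2 b b.2).1
    change (σ a : E1) ∈ _
    rw [h3]
    exact h4
  have h5 : ∑ e ∈ s, g ((φ (e : E1)).symm w) = ∑ x ∈ Finset.univ.image σ, g x := by
    rw [Finset.sum_image (fun a _ b _ h => hσ h), ← Finset.sum_coe_sort s]
  change ∑ e ∈ s, g ((φ (e : E1)).symm w) ≤ _
  rw [h5]
  exact (hs w).sum_le_tsum _ (fun x _ => h0 x)

theorem HasC0FibreSum.add {f g : E1 → ℝ} (hf : E.HasC0FibreSum f) (hg : E.HasC0FibreSum g) :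
    E.HasC0FibreSum (f + g) := by
  obtain ⟨a, ha⟩ := hf
  obtain ⟨b, hb⟩ := hg
  exact ⟨a + b, fun v => (ha v).add (hb v)⟩

theorem HasC0FibreSum.const_mul {f : E1 → ℝ} (hf : E.HasC0FibreSum f) (c : ℝ) :
    E.HasC0FibreSum fun e => c * f e := by
  obtain ⟨a, ha⟩ := hf
  exact ⟨c • a, fun v => by simpa using (ha v).mul_left c⟩

theorem HasC0FibreSum.mono [T2Space E1] {f g : E1 → ℝ} (hf : E.HasC0FibreSum f)
    (hfc : Continuous f) (hgc : Continuous g) (h0 : ∀ e, 0 ≤ g e) (hgf : ∀ e, g e ≤ f e) :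
    E.HasC0FibreSum g := by
  obtain ⟨a, ha⟩ := hf
  have hsg : ∀ v, Summable fun e : E.Fib v => g e := fun v =>
    Summable.of_nonneg_of_le (fun e => h0 e) (fun e => hgf e) (ha v).summable
  have hsf : ∀ v, Summable fun e : E.Fib v => f e - g e := fun v => (ha v).summable.sub (hsg v)
  have h1 := E.lowerSemicontinuous_fibreSum hgc h0 hsg
  have h2 := E.lowerSemicontinuous_fibreSum (hfc.sub hgc) (fun e => sub_nonneg.2 (hgf e)) hsf
  have h3 : (fun v => ∑' e : E.Fib v, g e) =
      fun v => a v + -(∑' e : E.Fib v, (f e - g e)) := by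
    funext v
    have := ((hsg v).hasSum.add (hsf v).hasSum).unique (by simpa using ha v)
    linarith
  have hc : Continuous fun v => ∑' e : E.Fib v, g e := by
    rw [continuous_iff_lower_upperSemicontinuous]
    refine ⟨h1, ?_⟩
    rw [h3]
    exact (map_continuous a).upperSemicontinuous.add
      (continuous_neg.comp_lowerSemicontinuous_antitone h2 fun x y h => neg_le_neg h)
  refine ⟨⟨⟨_, hc⟩, ?_⟩, fun v => (hsg v).hasSum⟩
  refine squeeze_zero (fun v => tsum_nonneg fun e => h0 e) (fun v => ?_) (zero_at_infty a)
  change (∑' e : E.Fib v, g e) ≤ a v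
  exact hasSum_le (fun e : E.Fib v => hgf e) (hsg v).hasSum (ha v)

theorem HasC0FibreSum.add_norm_sq [T2Space E1] {ξ η : C(E1, ℂ)}
    (hξ : E.HasC0FibreSum fun e => ‖ξ e‖ ^ 2) (hη : E.HasC0FibreSum fun e => ‖η e‖ ^ 2) :
    E.HasC0FibreSum fun e => ‖(ξ + η) e‖ ^ 2 := by
  refine HasC0FibreSum.mono E ((HasC0FibreSum.add E hξ hη).const_mul E 2) ?_ ?_
    (fun e => by positivity) fun e => ?_
  · simp only [Pi.add_apply]
    fun_prop
  · fun_prop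
  · have h1 : ‖ξ e + η e‖ ≤ ‖ξ e‖ + ‖η e‖ := norm_add_le _ _
    have h2 := norm_nonneg (ξ e + η e)
    simp only [ContinuousMap.add_apply, Pi.add_apply]
    nlinarith [sq_nonneg (‖ξ e‖ - ‖η e‖)]

/-- The linear space `C_d(E¹)` of all continuous `ξ` on `E¹` such that
`⟨ξ, ξ⟩(v) = ∑_{e ∈ d⁻¹(v)} |ξ(e)|²` defines an element of `C₀(E⁰)`. -/
def cdSubmodule [T2Space E1] : Submodule ℂ C(E1, ℂ) where
  carrier := {ξ | E.HasC0FibreSum fun e => ‖ξ e‖ ^ 2}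
  zero_mem' := ⟨0, fun v => by simp⟩
  add_mem' hξ hη := HasC0FibreSum.add_norm_sq E hξ hη
  smul_mem' := by
    intro c ξ hξ
    have h : E.HasC0FibreSum fun e => ‖c‖ ^ 2 * ‖ξ e‖ ^ 2 :=
      
      HasC0FibreSum.const_mul E (show E.HasC0FibreSum fun e => ‖ξ e‖ ^ 2 from hξ) (‖c‖ ^ 2)
    simpa [mul_pow] using h

/-- The space `C_d(E¹)`, with the norm and the `C₀(E⁰)`-valued inner product defined below. -/
def Cd [T2Space E1] : Type u := ↥E.cdSubmodule

variable [T2Space E1]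

instance : AddCommGroup E.Cd := inferInstanceAs (AddCommGroup ↥E.cdSubmodule)

instance : Module ℂ E.Cd := inferInstanceAs (Module ℂ ↥E.cdSubmodule)

instance : FunLike E.Cd E1 ℂ where
  coe ξ := fun e => ξ.1 e
  coe_injective _ _ h := Subtype.ext (DFunLike.coe_injective h)

variable {E}

@[simp] theorem Cd.add_apply (ξ η : E.Cd) (e : E1) : (ξ + η) e = ξ e + η e := rfl

@[simp] theorem Cd.smul_apply (c : ℂ) (ξ : E.Cd) (e : E1) : (c • ξ) e = c * ξ e := rfl

@[simp] theorem Cd.zero_apply (e : E1) : (0 : E.Cd) e = 0 := rfl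

@[simp] theorem Cd.neg_apply (ξ : E.Cd) (e : E1) : (-ξ) e = -ξ e := rfl

@[simp] theorem Cd.sub_apply (ξ η : E.Cd) (e : E1) : (ξ - η) e = ξ e - η e := rfl

theorem Cd.continuous (ξ : E.Cd) : Continuous ξ := ξ.1.continuous

theorem Cd.hasC0FibreSum (ξ : E.Cd) : E.HasC0FibreSum fun e => ‖ξ e‖ ^ 2 := ξ.2

/-- The restriction of `ξ ∈ C_d(E¹)` to a fibre of `d`, as a square summable family. -/
def Cd.fib (v : E0) : E.Cd →ₗ[ℂ] lp (fun _ : E.Fib v => ℂ) 2 where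
  toFun ξ := ⟨fun e => ξ e, memℓp_gen (by
    obtain ⟨h, hh⟩ := ξ.hasC0FibreSum
    simpa using (hh v).summable)⟩
  map_add' ξ η := rfl
  map_smul' c ξ := rfl

theorem Cd.fib_apply (v : E0) (ξ : E.Cd) (e : E.Fib v) : Cd.fib v ξ e = ξ e := rfl

theorem Cd.hasSum_fib (v : E0) (ξ : E.Cd) :
    HasSum (fun e : E.Fib v => ‖ξ e‖ ^ 2) (‖Cd.fib v ξ‖ ^ 2) := by
  have h := lp.hasSum_norm (p := 2) (by norm_num) (Cd.fib v ξ)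
  simp only [ENNReal.toReal_ofNat, Real.rpow_ofNat] at h
  exact h

theorem Cd.exists_norm_fib (ξ : E.Cd) : ∃ h : C₀(E0, ℝ), ∀ v, ‖Cd.fib v ξ‖ ^ 2 = h v := by
  obtain ⟨h, hh⟩ := ξ.hasC0FibreSum
  exact ⟨h, fun v => (Cd.hasSum_fib v ξ).unique (hh v)⟩

theorem Cd.inner_fib (v : E0) (ξ η : E.Cd) :
    inner ℂ (Cd.fib v ξ) (Cd.fib v η) = ∑' e : E.Fib v, conj (ξ e) * η e := by
  rw [lp.inner_eq_tsum]
  exact tsum_congr fun e => by rw [RCLike.inner_apply, mul_comm]; rfl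

theorem Cd.continuous_inner (ξ η : E.Cd) :
    Continuous fun v => ∑' e : E.Fib v, conj (ξ e) * η e := by
  have h : ∀ ζ : E.Cd, Continuous fun v => ((‖Cd.fib v ζ‖ : ℂ)) ^ 2 := fun ζ => by
    obtain ⟨h, hh⟩ := ζ.exists_norm_fib
    simp_rw [← Complex.ofReal_pow, hh]
    exact Complex.continuous_ofReal.comp (map_continuous h)
  have e : (fun v => ∑' e : E.Fib v, conj (ξ e) * η e) = fun v =>
      (((‖Cd.fib v (ξ + η)‖ : ℂ)) ^ 2 - ((‖Cd.fib v (ξ - η)‖ : ℂ)) ^ 2 +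
        (((‖Cd.fib v (ξ - Complex.I • η)‖ : ℂ)) ^ 2
          - ((‖Cd.fib v (ξ + Complex.I • η)‖ : ℂ)) ^ 2) * Complex.I) / 4 := by
    funext v
    rw [← Cd.inner_fib, inner_eq_sum_norm_sq_div_four]
    simp only [map_add, map_sub, map_smul]
    rfl
  rw [e]
  exact ((((h _).sub (h _)).add (((h _).sub (h _)).mul continuous_const))).div_const _

/-- The inner product `⟨ξ, η⟩(v) = ∑_{e ∈ d⁻¹(v)} conj (ξ(e)) η(e)`, an element of `C₀(E⁰)`. -/
def Cd.ip (ξ η : E.Cd) : C₀(E0, ℂ) where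
  toFun v := ∑' e : E.Fib v, conj (ξ e) * η e
  continuous_toFun := Cd.continuous_inner ξ η
  zero_at_infty' := by
    obtain ⟨a, ha⟩ := ξ.exists_norm_fib
    obtain ⟨b, hb⟩ := η.exists_norm_fib
    have h : Filter.Tendsto (fun v => √(a v) * √(b v)) (Filter.cocompact E0) (𝓝 0) := by
      simpa using ((Real.continuous_sqrt.tendsto 0).comp (zero_at_infty a)).mul
        ((Real.continuous_sqrt.tendsto 0).comp (zero_at_infty b))
    refine squeeze_zero_norm (fun v => ?_) h
    rw [← Cd.inner_fib, ← ha, ← hb, Real.sqrt_sq (norm_nonneg _), Real.sqrt_sq (norm_nonneg _)]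
    exact norm_inner_le_norm _ _

theorem Cd.ip_apply (ξ η : E.Cd) (v : E0) : Cd.ip ξ η v = ∑' e : E.Fib v, conj (ξ e) * η e := rfl

theorem Cd.ip_eq_inner (ξ η : E.Cd) (v : E0) :
    Cd.ip ξ η v = inner ℂ (Cd.fib v ξ) (Cd.fib v η) := (Cd.inner_fib v ξ η).symm

/-- The norm `‖ξ‖ = sup_v ⟨ξ, ξ⟩(v)^{1/2} = ‖⟨ξ, ξ⟩‖^{1/2}`. -/
instance : Norm E.Cd := ⟨fun ξ => √‖Cd.ip ξ ξ‖⟩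

theorem Cd.norm_def (ξ : E.Cd) : ‖ξ‖ = √‖Cd.ip ξ ξ‖ := rfl

theorem Cd.norm_sq (ξ : E.Cd) : ‖ξ‖ ^ 2 = ‖Cd.ip ξ ξ‖ := Real.sq_sqrt (norm_nonneg _)

theorem Cd.norm_ip_self_apply (ξ : E.Cd) (v : E0) : ‖Cd.ip ξ ξ v‖ = ‖Cd.fib v ξ‖ ^ 2 := by
  rw [Cd.ip_eq_inner, inner_self_eq_norm_sq_to_K]
  simp

theorem norm_apply_le_C0 (f : C₀(E0, ℂ)) (v : E0) : ‖f v‖ ≤ ‖f‖ :=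
  f.toBCF.norm_coe_le_norm v

theorem norm_le_C0 {f : C₀(E0, ℂ)} {c : ℝ} (hc : 0 ≤ c) (h : ∀ v, ‖f v‖ ≤ c) : ‖f‖ ≤ c :=
  (BoundedContinuousFunction.norm_le hc).2 h

theorem Cd.norm_fib_le (ξ : E.Cd) (v : E0) : ‖Cd.fib v ξ‖ ≤ ‖ξ‖ := by
  refine Real.le_sqrt_of_sq_le ?_
  rw [← Cd.norm_ip_self_apply]
  exact norm_apply_le_C0 _ v

theorem Cd.norm_le {ξ : E.Cd} {c : ℝ} (hc : 0 ≤ c) (h : ∀ v, ‖Cd.fib v ξ‖ ≤ c) : ‖ξ‖ ≤ c := by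
  refine (Real.sqrt_le_left hc).2 (norm_le_C0 (by positivity) fun v => ?_)
  rw [Cd.norm_ip_self_apply]
  exact pow_le_pow_left₀ (norm_nonneg _) (h v) 2

theorem Cd.normedSpaceCore : NormedSpace.Core ℂ E.Cd where
  norm_nonneg ξ := Real.sqrt_nonneg _
  norm_smul c ξ := by
    have key : ∀ (c : ℂ) (ξ : E.Cd), ‖c • ξ‖ ≤ ‖c‖ * ‖ξ‖ := fun c ξ =>
      Cd.norm_le (mul_nonneg (norm_nonneg _) (Real.sqrt_nonneg _)) fun v => by
        rw [map_smul, norm_smul]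
        exact mul_le_mul_of_nonneg_left (Cd.norm_fib_le ξ v) (norm_nonneg _)
    refine le_antisymm (key c ξ) ?_
    by_cases hc : c = 0
    · subst hc
      rw [norm_zero, zero_mul]
      exact Real.sqrt_nonneg _
    · have h := key c⁻¹ (c • ξ)
      rw [smul_smul, inv_mul_cancel₀ hc, one_smul, norm_inv] at h
      rwa [← div_eq_inv_mul, le_div_iff₀' (norm_pos_iff.2 hc)] at h
  norm_triangle ξ η := by
    refine Cd.norm_le (add_nonneg (Real.sqrt_nonneg _) (Real.sqrt_nonneg _)) fun v => ?_
    rw [map_add]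
    exact (norm_add_le _ _).trans (add_le_add (Cd.norm_fib_le ξ v) (Cd.norm_fib_le η v))
  norm_eq_zero_iff ξ := by
    constructor
    · intro h
      refine DFunLike.ext _ _ fun e => ?_
      have h1 : Cd.fib (E.d e) ξ = 0 := norm_le_zero_iff.1 (h ▸ Cd.norm_fib_le ξ (E.d e))
      have h2 := Cd.fib_apply (E.d e) ξ ⟨e, rfl⟩
      rw [h1] at h2
      exact h2.symm
    · rintro rfl
      exact le_antisymm (Cd.norm_le le_rfl fun v => by simp) (Real.sqrt_nonneg _)

instance : NormedAddCommGroup E.Cd := NormedAddCommGroup.ofCore Cd.normedSpaceCore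

instance : NormedSpace ℂ E.Cd := NormedSpace.ofCore Cd.normedSpaceCore

theorem Cd.norm_le_of_pointwise {ξ η : E.Cd} {c : ℝ} (hc : 0 ≤ c)
    (h : ∀ e, ‖ξ e‖ ≤ c * ‖η e‖) : ‖ξ‖ ≤ c * ‖η‖ := by
  refine Cd.norm_le (by positivity) fun v => ?_
  refine le_trans ?_ (mul_le_mul_of_nonneg_left (Cd.norm_fib_le η v) hc)
  refine le_of_sq_le_sq ?_ (by positivity)
  rw [mul_pow]
  refine hasSum_le (fun e => ?_) (Cd.hasSum_fib v ξ) ((Cd.hasSum_fib v η).mul_left (c ^ 2))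
  rw [← mul_pow]
  exact pow_le_pow_left₀ (norm_nonneg _) (h e) 2

theorem Cd.norm_ip_le (ξ η : E.Cd) : ‖Cd.ip ξ η‖ ≤ ‖ξ‖ * ‖η‖ := by
  refine norm_le_C0 (by positivity) fun v => ?_
  rw [Cd.ip_eq_inner]
  exact (norm_inner_le_norm _ _).trans
    (mul_le_mul (Cd.norm_fib_le ξ v) (Cd.norm_fib_le η v) (norm_nonneg _) (norm_nonneg _))

theorem Cd.ip_add_right (ξ η ζ : E.Cd) : Cd.ip ξ (η + ζ) = Cd.ip ξ η + Cd.ip ξ ζ := by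
  ext v
  simp only [ZeroAtInftyContinuousMap.add_apply, Cd.ip_eq_inner, map_add, inner_add_right]

theorem Cd.ip_smul_right (c : ℂ) (ξ η : E.Cd) : Cd.ip ξ (c • η) = c • Cd.ip ξ η := by
  ext v
  simp only [ZeroAtInftyContinuousMap.smul_apply, Cd.ip_eq_inner, map_smul, inner_smul_right,
    smul_eq_mul]

theorem Cd.star_ip (ξ η : E.Cd) : star (Cd.ip ξ η) = Cd.ip η ξ := by
  ext v
  simp only [ZeroAtInftyContinuousMap.star_apply, Cd.ip_eq_inner]
  exact inner_conj_symm _ _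

/-- The element of `C_d(E¹)` given by a continuous function. -/
def Cd.mk (f : E1 → ℂ) (hf : Continuous f) (h : E.HasC0FibreSum fun e => ‖f e‖ ^ 2) : E.Cd :=
  ⟨⟨f, hf⟩, h⟩

@[simp] theorem Cd.mk_apply (f : E1 → ℂ) (hf : Continuous f)
    (h : E.HasC0FibreSum fun e => ‖f e‖ ^ 2) (e : E1) : Cd.mk f hf h e = f e := rfl

@[ext] theorem Cd.ext {ξ η : E.Cd} (h : ∀ e, ξ e = η e) : ξ = η := DFunLike.ext _ _ h

theorem Cd.hasC0FibreSum_mul (g : E1 →ᵇ ℂ) (ξ : E.Cd) :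
    E.HasC0FibreSum fun e => ‖g e * ξ e‖ ^ 2 := by
  have hξ := ξ.continuous
  refine HasC0FibreSum.mono E (HasC0FibreSum.const_mul E ξ.hasC0FibreSum (‖g‖ ^ 2))
    (continuous_const.mul (hξ.norm.pow 2)) ((g.continuous.mul hξ).norm.pow 2)
    (fun e => sq_nonneg _) fun e => ?_
  rw [← mul_pow, norm_mul]
  exact pow_le_pow_left₀ (by positivity)
    (mul_le_mul_of_nonneg_right (g.norm_coe_le_norm e) (norm_nonneg _)) 2

/-- The operator `π(g)` of multiplication by a bounded continuous function `g` on `C_d(E¹)`. -/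
def mulOp (g : E1 →ᵇ ℂ) : E.Cd →L[ℂ] E.Cd :=
  LinearMap.mkContinuous
    { toFun := fun ξ =>
        Cd.mk (fun e => g e * ξ e) (g.continuous.mul ξ.continuous) (Cd.hasC0FibreSum_mul g ξ)
      map_add' := fun ξ η => Cd.ext fun e => mul_add (g e) (ξ e) (η e)
      map_smul' := fun c ξ => Cd.ext fun e => mul_left_comm (g e) c (ξ e) }
    ‖g‖ fun ξ => Cd.norm_le_of_pointwise (norm_nonneg _) fun e => by
      refine (norm_mul_le (g e) (ξ e)).trans ?_
      exact mul_le_mul_of_nonneg_right (g.norm_coe_le_norm e) (norm_nonneg _)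

@[simp] theorem mulOp_apply (g : E1 →ᵇ ℂ) (ξ : E.Cd) (e : E1) : mulOp g ξ e = g e * ξ e := rfl

variable (E) in
/-- The left action `π_r(f)ξ = (f ∘ r) ξ` of `C₀(E⁰)` on `C_d(E¹)`. -/
def leftAction (f : C₀(E0, ℂ)) : E.Cd →L[ℂ] E.Cd :=
  mulOp (f.toBCF.compContinuous ⟨E.r, E.continuous_r⟩)

@[simp] theorem leftAction_apply (f : C₀(E0, ℂ)) (ξ : E.Cd) (e : E1) :
    E.leftAction f ξ e = f (E.r e) * ξ e := rfl

/-- The right action `ξ f = ξ (f ∘ d)` of `C₀(E⁰)` on `C_d(E¹)`. -/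
def Cd.rightMul (ξ : E.Cd) (f : C₀(E0, ℂ)) : E.Cd :=
  mulOp (f.toBCF.compContinuous ⟨E.d, E.isLocalHomeomorph_d.continuous⟩) ξ

theorem Cd.rightMul_apply (ξ : E.Cd) (f : C₀(E0, ℂ)) (e : E1) :
    ξ.rightMul f e = ξ e * f (E.d e) := mul_comm _ _

theorem Cd.fib_rightMul (ξ : E.Cd) (f : C₀(E0, ℂ)) (v : E0) :
    Cd.fib v (ξ.rightMul f) = f v • Cd.fib v ξ := by
  ext e
  rw [Cd.fib_apply, Cd.rightMul_apply, lp.coeFn_smul, Pi.smul_apply, Cd.fib_apply, smul_eq_mul,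
    show E.d e = v from e.2, mul_comm]

theorem Cd.ip_rightMul (η ξ : E.Cd) (f : C₀(E0, ℂ)) :
    Cd.ip η (ξ.rightMul f) = Cd.ip η ξ * f := by
  ext v
  rw [ZeroAtInftyContinuousMap.mul_apply, Cd.ip_eq_inner, Cd.ip_eq_inner, Cd.fib_rightMul,
    inner_smul_right, mul_comm]

theorem Cd.norm_rightMul_le (ξ : E.Cd) (f : C₀(E0, ℂ)) : ‖ξ.rightMul f‖ ≤ ‖f‖ * ‖ξ‖ :=
  Cd.norm_le_of_pointwise (norm_nonneg _) fun e => by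
    rw [Cd.rightMul_apply, mul_comm, norm_mul]
    exact mul_le_mul_of_nonneg_right (norm_apply_le_C0 _ _) (norm_nonneg _)

/-- The rank one operator `θ_{ξ,η}(ζ) = ξ⟨η, ζ⟩`. -/
def theta (ξ η : E.Cd) : E.Cd →L[ℂ] E.Cd :=
  LinearMap.mkContinuous
    { toFun := fun ζ => ξ.rightMul (Cd.ip η ζ)
      map_add' := fun ζ ω => Cd.ext fun e => by
        simp only [Cd.rightMul_apply, Cd.add_apply, Cd.ip_add_right,
          ZeroAtInftyContinuousMap.add_apply, mul_add]
      map_smul' := fun c ζ => Cd.ext fun e => by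
        simp only [Cd.rightMul_apply, Cd.smul_apply, Cd.ip_smul_right, RingHom.id_apply,
          ZeroAtInftyContinuousMap.smul_apply, smul_eq_mul]
        ring }
    (‖ξ‖ * ‖η‖) fun ζ => by
      refine (Cd.norm_rightMul_le _ _).trans ?_
      calc ‖Cd.ip η ζ‖ * ‖ξ‖ ≤ ‖η‖ * ‖ζ‖ * ‖ξ‖ :=
            mul_le_mul_of_nonneg_right (Cd.norm_ip_le η ζ) (norm_nonneg _)
        _ = ‖ξ‖ * ‖η‖ * ‖ζ‖ := by ring

theorem theta_apply (ξ η ζ : E.Cd) : theta ξ η ζ = ξ.rightMul (Cd.ip η ζ) := rfl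

variable (E) in
/-- The space `K(C_d(E¹))` of compact operators, the closed linear span of the rank one operators
with respect to the operator norm. -/
def compacts : Submodule ℂ (E.Cd →L[ℂ] E.Cd) :=
  (Submodule.span ℂ {x | ∃ ξ η : E.Cd, x = theta ξ η}).topologicalClosure

theorem theta_mem_compacts (ξ η : E.Cd) : theta ξ η ∈ E.compacts :=
  Submodule.le_topologicalClosure _ (Submodule.subset_span ⟨ξ, η, rfl⟩)

section Regular

variable (E)

/-- The open set `E⁰_sce = E⁰ ∖ closure (r(E¹))` of sources. -/
def sources : Set E0 := (closure (Set.range E.r))ᶜ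

/-- The open set `E⁰_fin` of vertices with a neighbourhood `V` such that `r⁻¹(V)` is compact. -/
def finiteVertices : Set E0 := {v | ∃ V ∈ 𝓝 v, IsCompact (E.r ⁻¹' V)}

/-- The open set `E⁰_rg = E⁰_fin ∖ closure (E⁰_sce)` of regular vertices. -/
def regularVertices : Set E0 := E.finiteVertices \ closure E.sources

/-- `C₀(E⁰_rg)`, regarded as an ideal of `C₀(E⁰)`. -/
def regularFunctions : Set C₀(E0, ℂ) := {f | ∀ v, v ∉ E.regularVertices → f v = 0}

theorem hasC0FibreSum_of_hasCompactSupport [T2Space E0] {f : E1 → ℝ} (hf : Continuous f)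
    (hc : HasCompactSupport f) {φ : OpenPartialHomeomorph E1 E0} (hφ : E.d = φ)
    (hsub : tsupport f ⊆ φ.source) : E.HasC0FibreSum f := by
  classical
  let F : E0 → ℝ := fun v => if v ∈ φ.target then f (φ.symm v) else 0
  have hC : IsCompact (φ '' tsupport f) := by
    rw [← hφ]
    exact hc.isCompact.image E.isLocalHomeomorph_d.continuous
  have hF0 : ∀ v, v ∉ φ '' tsupport f → F v = 0 := by
    intro v hv
    by_cases ht : v ∈ φ.target
    · simp only [F, if_pos ht]
      by_contra hne
      exact hv ⟨φ.symm v, subset_tsupport f hne, φ.right_inv ht⟩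
    · simp only [F, if_neg ht]
  have hFc : HasCompactSupport F := HasCompactSupport.intro hC hF0
  have hts : tsupport F ⊆ φ '' tsupport f :=
    closure_minimal (fun v hv => by_contra fun h => hv (hF0 v h)) hC.isClosed
  have hcont : Continuous F := by
    refine continuous_of_tsupport fun v hv => ?_
    obtain ⟨e, he, rfl⟩ := hts hv
    have ht := φ.map_source (hsub he)
    have h1 : ContinuousAt (fun w => f (φ.symm w)) (φ e) :=
      hf.continuousAt.comp (φ.continuousAt_symm ht)
    refine h1.congr ?_
    filter_upwards [φ.open_target.mem_nhds ht] with w hw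
    simp only [F, if_pos hw]
  refine ⟨⟨⟨F, hcont⟩, hFc.is_zero_at_infty⟩, fun v => ?_⟩
  have hval : ∀ e : E.Fib v, f e ≠ 0 → v ∈ φ.target ∧ (e : E1) = φ.symm v := fun e he => by
    have hs := hsub (subset_tsupport f he)
    have h2 : φ e = v := by rw [← hφ]; exact e.2
    exact ⟨h2 ▸ φ.map_source hs, (φ.left_inv hs).symm.trans (congrArg φ.symm h2)⟩
  change HasSum _ (F v)
  by_cases ht : v ∈ φ.target
  · have h3 : E.d (φ.symm v) = v := by rw [hφ]; exact φ.right_inv ht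
    simp only [F, if_pos ht]
    refine hasSum_single (⟨φ.symm v, h3⟩ : E.Fib v) fun e he => ?_
    by_contra hne
    exact he (Subtype.ext (hval e hne).2)
  · simp only [F, if_neg ht]
    have h4 : (fun e : E.Fib v => f e) = fun _ => 0 := by
      funext e
      by_contra hne
      exact ht (hval e hne).1
    rw [h4]
    exact hasSum_zero

theorem mulOp_mem_compacts [T2Space E0] [LocallyCompactSpace E1] (g : E1 →ᵇ ℂ)
    (hg : ∀ ε > 0, IsCompact {e | ε ≤ ‖g e‖}) : (mulOp g : E.Cd →L[ℂ] E.Cd) ∈ E.compacts := by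
  classical
  refine Metric.mem_closure_iff.2 fun ε hε => ?_
  have hK := hg (ε / 2) (by positivity)
  set K := {e | ε / 2 ≤ ‖g e‖} with hKdef
  choose φ hφ hφd using fun e : E1 => E.isLocalHomeomorph_d e
  obtain ⟨t, ht⟩ := hK.elim_finite_subcover (fun e => (φ e).source) (fun e => (φ e).open_source)
    fun e _ => Set.mem_iUnion.2 ⟨e, hφ e⟩
  obtain ⟨p, hp, hpc⟩ := PartitionOfUnity.exists_isSubordinate_of_locallyFinite_t2space hK
    (fun e : t => (φ e).source) (fun e => (φ (e : E1)).open_source) (locallyFinite_of_finite _)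
    (fun x hx => by
      obtain ⟨e, he, hxe⟩ := Set.mem_iUnion₂.1 (ht hx)
      exact Set.mem_iUnion.2 ⟨⟨e, he⟩, hxe⟩)
  have hsc : ∀ k, Continuous fun e => ((√(p k e) : ℝ) : ℂ) := fun k => by fun_prop
  have hcd : ∀ (k : t) (c : E1 → ℂ), Continuous c →
      E.HasC0FibreSum fun e => ‖c e * ((√(p k e) : ℝ) : ℂ)‖ ^ 2 := by
    intro k c hc
    have hts : tsupport (fun e => ‖c e * ((√(p k e) : ℝ) : ℂ)‖ ^ 2) ⊆ tsupport (p k) :=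
      closure_mono fun e he hpe => he (by simp [hpe])
    exact E.hasC0FibreSum_of_hasCompactSupport ((hc.mul (hsc k)).norm.pow 2)
      ((hpc k).of_isClosed_subset (isClosed_tsupport _) hts) (hφd k) (hts.trans (hp k))
  let η : t → E.Cd := fun k => Cd.mk (fun e => 1 * ((√(p k e) : ℝ) : ℂ))
    (continuous_const.mul (hsc k)) (hcd k (fun _ => 1) continuous_const)
  let ξ : t → E.Cd := fun k => Cd.mk (fun e => g e * ((√(p k e) : ℝ) : ℂ))
    (g.continuous.mul (hsc k)) (hcd k g g.continuous)
  have hη : ∀ k e, η k e = ((√(p k e) : ℝ) : ℂ) := fun k e => one_mul _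
  have hξ : ∀ k e, ξ k e = g e * ((√(p k e) : ℝ) : ℂ) := fun k e => rfl
  have hθ : ∀ k (ζ : E.Cd) e, theta (ξ k) (η k) ζ e = g e * (p k e : ℂ) * ζ e := by
    intro k ζ e
    rw [theta_apply, Cd.rightMul_apply, Cd.ip_apply, hξ]
    by_cases hpe : p k e = 0
    · simp [hpe]
    rw [tsum_eq_single (⟨e, rfl⟩ : E.Fib (E.d e)), hη, Complex.conj_ofReal]
    · have h1 : ((√(p k e) : ℝ) : ℂ) * ((√(p k e) : ℝ) : ℂ) = (p k e : ℂ) := by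
        rw [← Complex.ofReal_mul, Real.mul_self_sqrt (p.nonneg k e)]
      rw [← h1]
      ring
    · intro e' hne
      rw [hη]
      by_cases hpe' : p k e' = 0
      · simp [hpe']
      exfalso
      apply hne
      have ha := hp k (subset_tsupport _ hpe)
      have hb := hp k (subset_tsupport _ hpe')
      refine Subtype.ext ((φ (k : E1)).injOn hb ha ?_)
      rw [← hφd k]
      exact e'.2
  refine ⟨∑ k, theta (ξ k) (η k),
    Submodule.sum_mem _ fun k _ => Submodule.subset_span ⟨_, _, rfl⟩, ?_⟩
  rw [dist_eq_norm]
  refine lt_of_le_of_lt (ContinuousLinearMap.opNorm_le_bound _ (by positivity : 0 ≤ ε / 2)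
    fun ζ => Cd.norm_le_of_pointwise (by positivity) fun e => ?_) (half_lt_self hε)
  have hsum : ∀ (s : Finset t) (F : t → E.Cd), (∑ k ∈ s, F k) e = ∑ k ∈ s, F k e := by
    intro s F
    induction s using Finset.induction_on with
    | empty => simp
    | insert a s ha ih => rw [Finset.sum_insert ha, Finset.sum_insert ha, Cd.add_apply, ih]
  have hval : ((mulOp g - ∑ k, theta (ξ k) (η k) : E.Cd →L[ℂ] E.Cd) ζ) e
      = g e * ((1 - ∑ k, p k e : ℝ) : ℂ) * ζ e := by
    rw [sub_apply, Cd.sub_apply, sum_apply, hsum,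
      mulOp_apply]
    simp_rw [hθ]
    rw [← Finset.sum_mul, ← Finset.mul_sum]
    push_cast
    ring
  rw [hval, norm_mul, norm_mul, Complex.norm_real]
  refine mul_le_mul_of_nonneg_right ?_ (norm_nonneg _)
  have hfin : ∑ᶠ k, p k e = ∑ k, p k e := finsum_eq_sum_of_fintype _
  by_cases he : e ∈ K
  · have h1 := p.sum_eq_one he
    rw [hfin] at h1
    rw [h1]
    simp only [sub_self, norm_zero, mul_zero]
    positivity
  · have h1 := p.sum_le_one e
    have h2 := p.sum_nonneg e
    rw [hfin] at h1 h2
    have h3 : ‖g e‖ < ε / 2 := not_le.1 he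
    have h4 : ‖1 - ∑ k, p k e‖ ≤ 1 := by
      rw [Real.norm_eq_abs, abs_le]
      constructor <;> linarith
    nlinarith [norm_nonneg (g e)]

theorem leftAction_mem_compacts [T2Space E0] [LocallyCompactSpace E1] {f : C₀(E0, ℂ)}
    (hf : f ∈ E.regularFunctions) : E.leftAction f ∈ E.compacts := by
  refine E.mulOp_mem_compacts _ fun ε hε => ?_
  have hK : IsCompact {v | ε ≤ ‖f v‖} := by
    have h1 : ∀ᶠ v in Filter.cocompact E0, ‖f v‖ < ε := by
      have h2 := (zero_at_infty f).norm
      rw [norm_zero] at h2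
      exact h2.eventually (gt_mem_nhds hε)
    obtain ⟨C, hC, hCs⟩ := Filter.mem_cocompact.1 h1
    refine hC.of_isClosed_subset
      (isClosed_le continuous_const (map_continuous f).norm) fun v hv => ?_
    by_contra hvC
    exact not_le.2 (show ‖f v‖ < ε from hCs hvC) hv
  have hV : ∀ v ∈ {v | ε ≤ ‖f v‖}, ∃ V ∈ 𝓝 v, IsCompact (E.r ⁻¹' V) := by
    intro v hv
    by_contra h
    have h3 : f v = 0 := hf v fun h4 => h h4.1
    have hv' : ε ≤ ‖f v‖ := hv
    rw [h3, norm_zero] at hv'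
    exact absurd hε (not_lt.2 hv')
  choose! V hVn hVc using hV
  obtain ⟨t, ht, hcov⟩ := hK.elim_nhds_subcover V hVn
  refine (t.isCompact_biUnion fun v hv => hVc v (ht v hv)).of_isClosed_subset
    (isClosed_le continuous_const (BoundedContinuousFunction.continuous _).norm) fun e he => ?_
  obtain ⟨v, hv, hev⟩ := Set.mem_iUnion₂.1 (hcov (show E.r e ∈ {v | ε ≤ ‖f v‖} from he))
  exact Set.mem_iUnion₂.2 ⟨v, hv, hev⟩

end Regular

end HilbertModule

section Pairs

variable (E : TopologicalGraph E0 E1) [T2Space E1]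

/-- A Toeplitz `E`-pair on a C⋆-algebra `A`. -/
structure ToeplitzPair (A : Type v) [NonUnitalCStarAlgebra A] where
  /-- the ⋆-homomorphism `T⁰` -/
  T0 : C₀(E0, ℂ) →⋆ₙₐ[ℂ] A
  /-- the linear map `T¹` -/
  T1 : E.Cd →ₗ[ℂ] A
  star_T1_mul_T1 : ∀ ξ η, star (T1 ξ) * T1 η = T0 (Cd.ip ξ η)
  T0_mul_T1 : ∀ f ξ, T0 f * T1 ξ = T1 (E.leftAction f ξ)

namespace ToeplitzPair

variable {E} {A : Type v} [NonUnitalCStarAlgebra A] (T : E.ToeplitzPair A)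

theorem norm_T0_le (f : C₀(E0, ℂ)) : ‖T.T0 f‖ ≤ ‖f‖ :=
  NonUnitalStarAlgHom.norm_apply_le T.T0 f

theorem norm_T1_le (ξ : E.Cd) : ‖T.T1 ξ‖ ≤ ‖ξ‖ := by
  refine le_of_sq_le_sq ?_ (norm_nonneg _)
  rw [Cd.norm_sq, sq, ← CStarRing.norm_star_mul_self, T.star_T1_mul_T1]
  exact T.norm_T0_le _

theorem T1_mul_T0 (ξ : E.Cd) (f : C₀(E0, ℂ)) : T.T1 ξ * T.T0 f = T.T1 (ξ.rightMul f) := by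
  rw [← sub_eq_zero, ← CStarRing.star_mul_self_eq_zero_iff]
  have h1 : ∀ η : E.Cd, ∀ g, star (T.T1 η) * (T.T1 ξ * T.T0 g) = T.T0 (Cd.ip η (ξ.rightMul g)) := by
    intro η g
    rw [← mul_assoc, T.star_T1_mul_T1, Cd.ip_rightMul, map_mul]
  have h2 : ∀ η : E.Cd, star (T.T1 η) * (T.T1 ξ * T.T0 f - T.T1 (ξ.rightMul f)) = 0 := by
    intro η
    rw [mul_sub, h1, T.star_T1_mul_T1, sub_self]
  rw [star_sub, star_mul, sub_mul, mul_assoc, h2, h2, mul_zero, sub_zero]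

theorem norm_sum_T1_mul_star_le {ι : Type*} (s : Finset ι) (ξ η : ι → E.Cd) :
    ‖∑ i ∈ s, T.T1 (ξ i) * star (T.T1 (η i))‖ ≤ ‖∑ i ∈ s, theta (ξ i) (η i)‖ := by
  set a := ∑ i ∈ s, T.T1 (ξ i) * star (T.T1 (η i)) with ha
  set k := ∑ i ∈ s, theta (ξ i) (η i) with hk
  set k' := ∑ i ∈ s, theta (η i) (ξ i) with hk'
  have hmul : ∀ x y ζ : E.Cd, T.T1 x * star (T.T1 y) * T.T1 ζ = T.T1 (theta x y ζ) := by
    intro x y ζ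
    rw [mul_assoc, T.star_T1_mul_T1, T.T1_mul_T0, theta_apply]
  have haT : ∀ ζ, a * T.T1 ζ = T.T1 (k ζ) := by
    intro ζ
    rw [ha, hk, Finset.sum_mul, sum_apply, map_sum]
    exact Finset.sum_congr rfl fun i _ => hmul _ _ _
  have hsa : star a = ∑ i ∈ s, T.T1 (η i) * star (T.T1 (ξ i)) := by
    rw [ha, star_sum]
    exact Finset.sum_congr rfl fun i _ => by rw [star_mul, star_star]
  have haT' : ∀ ζ, star a * T.T1 ζ = T.T1 (k' ζ) := by
    intro ζ
    rw [hsa, hk', Finset.sum_mul, sum_apply, map_sum]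
    exact Finset.sum_congr rfl fun i _ => hmul _ _ _
  have hadj1 : ∀ x y ζ ω : E.Cd, Cd.ip (theta x y ζ) ω = Cd.ip ζ (theta y x ω) := by
    intro x y ζ ω
    ext v
    rw [theta_apply, theta_apply, Cd.ip_eq_inner, Cd.ip_eq_inner, Cd.fib_rightMul,
      Cd.fib_rightMul, inner_smul_left, inner_smul_right, Cd.ip_eq_inner, Cd.ip_eq_inner,
      inner_conj_symm, mul_comm]
  have hipsum : ∀ (t : Finset ι) (ζ : E.Cd) (F : ι → E.Cd),
      Cd.ip ζ (∑ i ∈ t, F i) = ∑ i ∈ t, Cd.ip ζ (F i) := by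
    classical
    intro t ζ F
    induction t using Finset.induction_on with
    | empty =>
      have := Cd.ip_smul_right 0 ζ (0 : E.Cd)
      simpa using this
    | insert i t hi ih => rw [Finset.sum_insert hi, Finset.sum_insert hi, Cd.ip_add_right, ih]
  have hadj : ∀ ζ ω : E.Cd, Cd.ip (k ζ) ω = Cd.ip ζ (k' ω) := by
    intro ζ ω
    rw [hk, hk', sum_apply, sum_apply, hipsum,
      ← Cd.star_ip, hipsum, star_sum]
    exact Finset.sum_congr rfl fun i _ => by rw [Cd.star_ip, hadj1]
  have hk'le : ‖k'‖ ≤ ‖k‖ := by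
    refine ContinuousLinearMap.opNorm_le_bound _ (norm_nonneg _) fun ζ => ?_
    have h1 : ‖k' ζ‖ ^ 2 ≤ ‖k‖ * ‖k' ζ‖ * ‖ζ‖ := by
      rw [Cd.norm_sq, ← hadj]
      exact (Cd.norm_ip_le _ _).trans
        (mul_le_mul_of_nonneg_right (k.le_opNorm _) (norm_nonneg _))
    rcases (norm_nonneg (k' ζ)).eq_or_lt with h0 | h0
    · rw [← h0]
      positivity
    · refine le_of_mul_le_mul_right ?_ h0
      nlinarith
  -- `p j = (a a⋆)^(2^j)`, computed by repeated squaring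
  have key : ∀ j : ℕ, ∃ (p : A) (S w : E.Cd →L[ℂ] E.Cd), IsSelfAdjoint p ∧
      ‖p‖ = ‖a‖ ^ (2 * 2 ^ j) ∧ (∀ ζ, p * T.T1 ζ = T.T1 (S ζ)) ∧ ‖S‖ ≤ ‖k‖ ^ (2 * 2 ^ j) ∧
      p = ∑ i ∈ s, T.T1 (w (η i)) * star (T.T1 (ξ i)) ∧ ‖w‖ * ‖k‖ ≤ ‖k‖ ^ (2 * 2 ^ j) := by
    intro j
    induction j with
    | zero =>
      refine ⟨a * star a, k.comp k', k, IsSelfAdjoint.mul_star_self a, ?_, fun ζ => ?_, ?_, ?_, ?_⟩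
      · rw [CStarRing.norm_self_mul_star]
        ring
      · rw [mul_assoc, haT', haT]
        rfl
      · refine (ContinuousLinearMap.opNorm_comp_le _ _).trans ?_
        rw [pow_zero, mul_one, sq]
        exact mul_le_mul_of_nonneg_left hk'le (norm_nonneg _)
      · rw [hsa, Finset.mul_sum]
        exact Finset.sum_congr rfl fun i _ => by rw [← mul_assoc, haT]
      · rw [pow_zero, mul_one, sq]
    | succ j ih =>
      obtain ⟨p, S, w, h1, h2, h3, h4, h5, h6⟩ := ih
      have hexp : 2 * 2 ^ (j + 1) = 2 * 2 ^ j + 2 * 2 ^ j := by ring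
      refine ⟨p * p, S.comp S, S.comp w, ?_, ?_, fun ζ => ?_, ?_, ?_, ?_⟩
      · simpa [h1.star_eq] using IsSelfAdjoint.star_mul_self p
      · have h7 := CStarRing.norm_star_mul_self (x := p)
        rw [h1.star_eq] at h7
        rw [h7, h2, hexp, pow_add]
      · rw [mul_assoc, h3, h3]
        rfl
      · rw [hexp, pow_add]
        exact (ContinuousLinearMap.opNorm_comp_le _ _).trans
          (mul_le_mul h4 h4 (norm_nonneg _) (by positivity))
      · nth_rewrite 2 [h5]
        rw [Finset.mul_sum]
        exact Finset.sum_congr rfl fun i _ => by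
          rw [← mul_assoc, h3]
          rfl
      · rw [hexp, pow_add]
        calc ‖S.comp w‖ * ‖k‖ ≤ ‖S‖ * ‖w‖ * ‖k‖ :=
              mul_le_mul_of_nonneg_right (ContinuousLinearMap.opNorm_comp_le _ _) (norm_nonneg _)
          _ = ‖S‖ * (‖w‖ * ‖k‖) := mul_assoc _ _ _
          _ ≤ _ := mul_le_mul h4 h6 (by positivity) (by positivity)
  set M := ∑ i ∈ s, ‖η i‖ * ‖ξ i‖ with hM
  have hbound : ∀ j : ℕ, ‖a‖ ^ (2 * 2 ^ j) * ‖k‖ ≤ M * ‖k‖ ^ (2 * 2 ^ j) := by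
    intro j
    obtain ⟨p, S, w, -, h2, -, -, h5, h6⟩ := key j
    have h7 : ‖p‖ ≤ M * ‖w‖ := by
      rw [h5, hM, Finset.sum_mul]
      refine norm_sum_le_of_le _ fun i _ => ?_
      refine (norm_mul_le _ _).trans ?_
      rw [norm_star]
      calc ‖T.T1 (w (η i))‖ * ‖T.T1 (ξ i)‖ ≤ (‖w‖ * ‖η i‖) * ‖ξ i‖ :=
            mul_le_mul ((T.norm_T1_le _).trans (w.le_opNorm _)) (T.norm_T1_le _) (norm_nonneg _)
              (by positivity)
        _ = ‖η i‖ * ‖ξ i‖ * ‖w‖ := by ring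
    have hM0 : 0 ≤ M := Finset.sum_nonneg fun i _ => by positivity
    rw [← h2]
    calc ‖p‖ * ‖k‖ ≤ M * ‖w‖ * ‖k‖ := mul_le_mul_of_nonneg_right h7 (norm_nonneg _)
      _ = M * (‖w‖ * ‖k‖) := mul_assoc _ _ _
      _ ≤ _ := mul_le_mul_of_nonneg_left h6 hM0
  rcases (norm_nonneg k).eq_or_lt with h0 | h0
  · have hk0 : k = 0 := norm_eq_zero.1 h0.symm
    have h8 : a * star a = 0 := by
      rw [hsa, Finset.mul_sum]
      refine Finset.sum_eq_zero fun i _ => ?_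
      rw [← mul_assoc, haT, hk0]
      simp
    have h9 := CStarRing.norm_self_mul_star (x := a)
    rw [h8, norm_zero] at h9
    rw [← h0]
    nlinarith [norm_nonneg a]
  · by_contra hlt
    have hlt' : 1 < ‖a‖ / ‖k‖ := (one_lt_div h0).2 (not_le.1 hlt)
    obtain ⟨n, hn⟩ := pow_unbounded_of_one_lt (M / ‖k‖) hlt'
    have h10 : n ≤ 2 * 2 ^ n := by
      have := Nat.lt_two_pow_self (n := n)
      omega
    have h11 := hn.trans_le (pow_le_pow_right₀ hlt'.le h10)
    rw [div_pow, div_lt_div_iff₀ h0 (by positivity)] at h11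
    exact absurd (hbound n) (not_le.2 h11)

instance : IsBoundedSMul ℂ E.compacts :=
  NormedSpace.toIsBoundedSMul (𝕜 := ℂ) (E := E.compacts)

variable (E) in
/-- Finite formal linear combinations of pairs `(ξ, η)`, mapped to `∑ θ_{ξ,η}`. -/
def sumTheta : (E.Cd × E.Cd →₀ ℂ) →ₗ[ℂ] E.compacts :=
  Finsupp.linearCombination ℂ fun p => ⟨theta p.1 p.2, theta_mem_compacts p.1 p.2⟩

/-- Finite formal linear combinations of pairs `(ξ, η)`, mapped to `∑ T¹(ξ) T¹(η)⋆`. -/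
def sumT1 : (E.Cd × E.Cd →₀ ℂ) →ₗ[ℂ] A :=
  Finsupp.linearCombination ℂ fun p => T.T1 p.1 * star (T.T1 p.2)

theorem norm_sumT1_le (c : E.Cd × E.Cd →₀ ℂ) : ‖T.sumT1 c‖ ≤ 1 * ‖sumTheta E c‖ := by
  have h := T.norm_sum_T1_mul_star_le c.support (fun p => c p • p.1) (fun p => p.2)
  have h1 : T.sumT1 c = ∑ p ∈ c.support, T.T1 (c p • p.1) * star (T.T1 p.2) := by
    rw [sumT1, Finsupp.linearCombination_apply, Finsupp.sum]
    exact Finset.sum_congr rfl fun p _ => by rw [map_smul, smul_mul_assoc]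
  have h2 : ((sumTheta E c : E.compacts) : E.Cd →L[ℂ] E.Cd)
      = ∑ p ∈ c.support, theta (c p • p.1) p.2 := by
    rw [sumTheta, Finsupp.linearCombination_apply, Finsupp.sum, Submodule.coe_sum]
    refine Finset.sum_congr rfl fun p _ => ?_
    ext ζ e
    simp only [Submodule.coe_smul, smul_apply, theta_apply, Cd.smul_apply,
      Cd.rightMul_apply]
    ring
  rw [one_mul, h1]
  change _ ≤ ‖((sumTheta E c : E.compacts) : E.Cd →L[ℂ] E.Cd)‖
  rw [h2]
  exact h

theorem denseRange_sumTheta : DenseRange (sumTheta E) := by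
  intro x
  rw [Metric.mem_closure_iff]
  intro ε hε
  obtain ⟨y, hy, hxy⟩ := Metric.mem_closure_iff.1 x.2 ε hε
  have h1 : ∀ y ∈ Submodule.span ℂ {x | ∃ ξ η : E.Cd, x = theta ξ η},
      ∃ c, ((sumTheta E c : E.compacts) : E.Cd →L[ℂ] E.Cd) = y := by
    intro y hy
    induction hy using Submodule.span_induction with
    | mem y h =>
      obtain ⟨ξ, η, rfl⟩ := h
      exact ⟨Finsupp.single (ξ, η) 1, by simp [sumTheta]⟩
    | zero => exact ⟨0, by simp⟩
    | add y z _ _ ihy ihz =>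
      obtain ⟨c, rfl⟩ := ihy
      obtain ⟨c', rfl⟩ := ihz
      exact ⟨c + c', by rw [map_add, Submodule.coe_add]⟩
    | smul a y _ ih =>
      obtain ⟨c, rfl⟩ := ih
      exact ⟨a • c, by rw [map_smul, Submodule.coe_smul]⟩
  obtain ⟨c, rfl⟩ := h1 y hy
  exact ⟨_, ⟨c, rfl⟩, hxy⟩

/-- The map `Φ¹ : K(C_d(E¹)) → A`, the unique continuous linear map such that
`Φ¹(θ_{ξ,η}) = T¹(ξ) T¹(η)⋆`. -/
def Phi : E.compacts →L[ℂ] A := LinearMap.extendOfNorm T.sumT1 (sumTheta E)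

theorem Phi_theta (ξ η : E.Cd) :
    T.Phi ⟨theta ξ η, theta_mem_compacts ξ η⟩ = T.T1 ξ * star (T.T1 η) := by
  have h := LinearMap.extendOfNorm_eq (f := T.sumT1) denseRange_sumTheta ⟨1, T.norm_sumT1_le⟩
    (Finsupp.single (ξ, η) 1)
  have h1 : sumTheta E (Finsupp.single (ξ, η) 1) = ⟨theta ξ η, theta_mem_compacts ξ η⟩ := by
    simp [sumTheta]
  have h2 : T.sumT1 (Finsupp.single (ξ, η) 1) = T.T1 ξ * star (T.T1 η) := by
    simp [sumT1]
  rw [h1, h2] at h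
  exact h

theorem Phi_unique (Ψ : E.compacts →L[ℂ] A)
    (hΨ : ∀ ξ η, Ψ ⟨theta ξ η, theta_mem_compacts ξ η⟩ = T.T1 ξ * star (T.T1 η)) :
    T.Phi = Ψ := by
  refine LinearMap.extendOfNorm_unique denseRange_sumTheta 1 T.norm_sumT1_le Ψ ?_
  refine Finsupp.lhom_ext' fun p => LinearMap.ext_ring ?_
  simpa [sumTheta, sumT1] using hΨ p.1 p.2

theorem norm_Phi_le (x : E.compacts) : ‖T.Phi x‖ ≤ ‖x‖ := by
  simpa using! LinearMap.norm_extendOfNorm_apply_le (f := T.sumT1) denseRange_sumTheta 1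
    T.norm_sumT1_le x

/-- `C⋆(T)`, the C⋆-subalgebra generated by the images of `T⁰` and `T¹`. -/
def algebra : NonUnitalStarSubalgebra ℂ A :=
  (NonUnitalStarAlgebra.adjoin ℂ (Set.range T.T0 ∪ Set.range T.T1)).topologicalClosure

instance : IsClosed (T.algebra : Set A) := isClosed_closure

theorem T0_mem (f : C₀(E0, ℂ)) : T.T0 f ∈ T.algebra :=
  NonUnitalStarSubalgebra.le_topologicalClosure _
    (NonUnitalStarAlgebra.subset_adjoin ℂ _ (Or.inl ⟨f, rfl⟩))

theorem T1_mem (ξ : E.Cd) : T.T1 ξ ∈ T.algebra :=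
  NonUnitalStarSubalgebra.le_topologicalClosure _
    (NonUnitalStarAlgebra.subset_adjoin ℂ _ (Or.inr ⟨ξ, rfl⟩))

end ToeplitzPair

/-- A Cuntz-Krieger `E`-pair: a Toeplitz `E`-pair with `T⁰(f) = Φ¹(π_r(f))` for all
`f ∈ C₀(E⁰_rg)`. -/
structure CuntzKriegerPair [T2Space E0] [LocallyCompactSpace E1] (A : Type v)
    [NonUnitalCStarAlgebra A] extends E.ToeplitzPair A where
  T0_eq_Phi : ∀ f (hf : f ∈ E.regularFunctions),
    T0 f = toToeplitzPair.Phi ⟨E.leftAction f, E.leftAction_mem_compacts hf⟩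

variable [T2Space E0] [LocallyCompactSpace E1]

/-- A Cuntz-Krieger `E`-pair together with the C⋆-algebra on which it is defined. -/
structure BundledPair : Type (u + 1) where
  /-- the C⋆-algebra -/
  carrier : Type u
  [cstar : NonUnitalCStarAlgebra carrier]
  /-- the Cuntz-Krieger pair on it -/
  pair : E.CuntzKriegerPair carrier

attribute [instance] BundledPair.cstar

/-- The `ℓ^∞`-product of the C⋆-algebras `A`, over all Cuntz-Krieger `E`-pairs on C⋆-algebras `A`
(in the universe of `E⁰` and `E¹`; a C⋆-algebra generated by a Cuntz-Krieger `E`-pair always has a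
copy in this universe). -/
abbrev BigProduct : Type (u + 1) := lp (fun i : E.BundledPair => i.carrier) ∞

variable {E} in
/-- The coordinate projection of the product onto the factor of a given pair. -/
def evalHom (i : E.BundledPair) : E.BigProduct →⋆ₙₐ[ℂ] i.carrier where
  toFun x := x i
  map_smul' _ _ := rfl
  map_zero' := rfl
  map_add' _ _ := rfl
  map_mul' _ _ := rfl
  map_star' _ := rfl

variable {E} in
theorem evalHom_apply (i : E.BundledPair) (x : E.BigProduct) : evalHom i x = x i := rfl

/-- The Toeplitz pair `((T⁰)_T, (T¹)_T)` on the product over all Cuntz-Krieger pairs `T`. -/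
def productPair : E.ToeplitzPair E.BigProduct where
  T0 :=
    { toFun := fun f => ⟨fun i => i.pair.T0 f, memℓp_infty ⟨‖f‖, by
        rintro _ ⟨i, rfl⟩
        exact i.pair.norm_T0_le f⟩⟩
      map_smul' := fun c f => by ext i; exact map_smul i.pair.T0 c f
      map_zero' := by ext i; exact map_zero i.pair.T0
      map_add' := fun f g => by ext i; exact map_add i.pair.T0 f g
      map_mul' := fun f g => by ext i; exact map_mul i.pair.T0 f g
      map_star' := fun f => by ext i; exact map_star i.pair.T0 f }
  T1 :=
    { toFun := fun ξ => ⟨fun i => i.pair.T1 ξ, memℓp_infty ⟨‖ξ‖, by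
        rintro _ ⟨i, rfl⟩
        exact i.pair.norm_T1_le ξ⟩⟩
      map_add' := fun ξ η => by ext i; exact map_add i.pair.T1 ξ η
      map_smul' := fun c ξ => by ext i; exact map_smul i.pair.T1 c ξ }
  star_T1_mul_T1 ξ η := by ext i; exact i.pair.star_T1_mul_T1 ξ η
  T0_mul_T1 f ξ := by ext i; exact i.pair.T0_mul_T1 f ξ

variable {E} in
theorem productPair_T0_apply (f : C₀(E0, ℂ)) (i : E.BundledPair) :
    E.productPair.T0 f i = i.pair.T0 f := rfl

variable {E} in
theorem productPair_T1_apply (ξ : E.Cd) (i : E.BundledPair) :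
    E.productPair.T1 ξ i = i.pair.T1 ξ := rfl

variable {E} in
theorem continuous_evalHom (i : E.BundledPair) : Continuous (evalHom i) :=
  AddMonoidHomClass.continuous_of_bound (evalHom i) 1 fun x => by
    simpa using NonUnitalStarAlgHom.norm_apply_le (evalHom i) x

/-- The universal Cuntz-Krieger pair `t = (t⁰, t¹)`, as a pair on the product. -/
def universalPair : E.CuntzKriegerPair E.BigProduct where
  toToeplitzPair := E.productPair
  T0_eq_Phi f hf := by
    ext i
    have h : i.pair.Phi = (⟨(evalHom i : E.BigProduct →ₗ[ℂ] i.carrier), continuous_evalHom i⟩ :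
        E.BigProduct →L[ℂ] i.carrier).comp E.productPair.Phi :=
      i.pair.Phi_unique _ fun ξ η => by
        change evalHom i (E.productPair.Phi _) = _
        rw [ToeplitzPair.Phi_theta]
        rfl
    have h1 := i.pair.T0_eq_Phi f hf
    rw [h] at h1
    exact h1

/-- The C⋆-algebra `O(E)`: the C⋆-algebra generated by the universal Cuntz-Krieger pair `t`, whose
norm is the supremum over all Cuntz-Krieger `E`-pairs. -/
abbrev CKAlgebra : NonUnitalStarSubalgebra ℂ E.BigProduct := E.universalPair.algebra

/-- `t⁰ : C₀(E⁰) → O(E)`. -/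
def t0 (f : C₀(E0, ℂ)) : E.CKAlgebra := ⟨E.universalPair.T0 f, E.universalPair.T0_mem f⟩

/-- `t¹ : C_d(E¹) → O(E)`. -/
def t1 (ξ : E.Cd) : E.CKAlgebra := ⟨E.universalPair.T1 ξ, E.universalPair.T1_mem ξ⟩

section Rho

variable {E} {A : Type u} [NonUnitalCStarAlgebra A] (T : E.CuntzKriegerPair A)

theorem evalHom_mem (x : E.CKAlgebra) : evalHom (⟨A, T⟩ : E.BundledPair) x ∈ T.algebra := by
  have h : E.CKAlgebra ≤ T.algebra.comap (evalHom (⟨A, T⟩ : E.BundledPair)) := by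
    refine NonUnitalStarSubalgebra.topologicalClosure_minimal _
      (NonUnitalStarAlgebra.adjoin_le ?_)
      (show IsClosed (evalHom (⟨A, T⟩ : E.BundledPair) ⁻¹' (T.algebra : Set A)) from
        IsClosed.preimage (continuous_evalHom _) isClosed_closure)
    rintro _ (⟨f, rfl⟩ | ⟨ξ, rfl⟩)
    · exact T.T0_mem f
    · exact T.T1_mem ξ
  exact h x.2

/-- The ⋆-homomorphism `ρ_T : O(E) → C⋆(T)`, the restriction to `O(E)` of the coordinate projection
of the product to the factor of `T`. -/
def rho : E.CKAlgebra →⋆ₙₐ[ℂ] T.algebra :=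
  NonUnitalStarAlgHom.codRestrict
    ((evalHom (⟨A, T⟩ : E.BundledPair)).comp (NonUnitalStarSubalgebraClass.subtype E.CKAlgebra))
    T.algebra (evalHom_mem T)

theorem rho_t0 (f : C₀(E0, ℂ)) : rho T (E.t0 f) = ⟨T.T0 f, T.T0_mem f⟩ := rfl

theorem rho_t1 (ξ : E.Cd) : rho T (E.t1 ξ) = ⟨T.T1 ξ, T.T1_mem ξ⟩ := rfl

/-- `ρ_T` is the only ⋆-homomorphism with `ρ_T ∘ tⁱ = Tⁱ` for `i = 0, 1`. -/
theorem rho_unique (φ : E.CKAlgebra →⋆ₙₐ[ℂ] T.algebra)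
    (h0 : ∀ f, φ (E.t0 f) = ⟨T.T0 f, T.T0_mem f⟩) (h1 : ∀ ξ, φ (E.t1 ξ) = ⟨T.T1 ξ, T.T1_mem ξ⟩) :
    φ = rho T := by
  have hcont : ∀ ψ : E.CKAlgebra →⋆ₙₐ[ℂ] T.algebra, Continuous ψ := fun ψ =>
    AddMonoidHomClass.continuous_of_bound ψ 1 fun x => by
      simpa using NonUnitalStarAlgHom.norm_apply_le ψ x
  let S := NonUnitalStarAlgHom.equalizer φ (rho T)
  have hS : IsClosed (S : Set E.CKAlgebra) := isClosed_eq (hcont φ) (hcont (rho T))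
  have hcl : IsClosed (E.CKAlgebra : Set E.BigProduct) := isClosed_closure
  have hle : E.CKAlgebra ≤ S.map (NonUnitalStarSubalgebraClass.subtype E.CKAlgebra) := by
    refine NonUnitalStarSubalgebra.topologicalClosure_minimal _
      (NonUnitalStarAlgebra.adjoin_le ?_) (hcl.isClosedEmbedding_subtypeVal.isClosedMap _ hS)
    rintro _ (⟨f, rfl⟩ | ⟨ξ, rfl⟩)
    · exact ⟨E.t0 f, (h0 f).trans (rho_t0 T f).symm, rfl⟩
    · exact ⟨E.t1 ξ, (h1 ξ).trans (rho_t1 T ξ).symm, rfl⟩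
  ext x
  obtain ⟨y, hy, hyx⟩ := hle x.2
  have hyx' : y = x := Subtype.ext hyx
  rw [← hyx']
  exact congrArg Subtype.val hy

end Rho

end Pairs

section TopologicallyFree

variable (E : TopologicalGraph E0 E1)

/-- The family `(p n, …, p 1, p 0)` of `n + 1 ≥ 1` edges is a loop: it is a path, i.e.
`d(p (k+1)) = r(p k)`, and its range `r(p n)` equals its domain `d(p 0)`. -/
def IsLoop {n : ℕ} (p : Fin (n + 1) → E1) : Prop :=
  (∀ k : Fin n, E.d (p k.succ) = E.r (p k.castSucc)) ∧ E.r (p (Fin.last n)) = E.d (p 0)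

/-- The loop `p` is without entrances: `r⁻¹(r(p k)) = {p k}` for all `k`. -/
def IsWithoutEntrances {n : ℕ} (p : Fin (n + 1) → E1) : Prop :=
  ∀ k, E.r ⁻¹' {E.r (p k)} = {p k}

/-- `E` is topologically free: the set of base points of loops without entrances has empty
interior. -/
def TopologicallyFree : Prop :=
  interior {v : E0 | ∃ (n : ℕ) (p : Fin (n + 1) → E1),
    E.IsLoop p ∧ E.IsWithoutEntrances p ∧ E.d (p 0) = v} = ∅

end TopologicallyFree

end

end TopologicalGraph

/-!
# The Cuntz-Krieger uniqueness theorem for topological graphs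

The point is that a ⋆-homomorphism `φ` which is injective on `T⁰(C₀(E⁰))` is isometric on the
C⋆-algebra `C⋆(S)` of a Cuntz-Krieger pair `S`, if the graph is topologically free
(`CuntzKriegerPair.norm_le_norm_map`). Applied to the universal pair and the coordinate projection
to the given pair, this makes `ρ_T` isometric; its range is then closed and contains the generators.

`C⋆(S)` is the closed span of monomials `T¹(ξ₁) ⋯ T¹(ξₐ) T⁰(f) T¹(η_b)⋆ ⋯ T¹(η₁)⋆` with compactly
supported `ξᵢ, ηⱼ`, graded by `a - b`. The heart of the matter is the inequality
`‖x‖ ≤ ‖φ(x + u)‖` for `x` of degree `0` and `u` without a part of degree `0`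
(`CuntzKriegerPair.norm_le_norm_map_add`). It is proved by induction on the length of the monomials
in `x`.

* For `x = T⁰(f)` one compresses by bump functions along a path that starts where `|f|` is large
  (`ToeplitzPair.norm_le_norm_map_T0_add`). By topological freeness
  (`TopologicallyFree.exists_walk`) there is either a path to a singular vertex, or a long path
  whose last edge does not occur earlier in it. In the second case the compression annihilates `u`.
  In the first case a further compression near the singular vertex does
  (`ToeplitzPair.norm_apply_le_of_notMem_regularVertices`).
* In the induction step let `x = T⁰(f) + y`, where all monomials in `y` start with some `T¹(ξ)`. The
  induction hypothesis bounds `x` on the products `T¹(ξ) z`, and `f` is bounded at the singular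
  vertices as before. The rest of `T⁰(f)` lies in the closed right ideal generated by these products,
  by the Cuntz-Krieger relation, so that `norm_le_of_bounded_on_subspace` applies.

Multiplying by adjoints of homogeneous elements one gets `‖w_k‖ ≤ ‖φ(w)‖` for every homogeneous part
`w_k` of a combination `w` of monomials, and hence `‖w‖ ≤ C ‖φ(w)‖`, where `C` is the number of
degrees that occur. As `C` grows only linearly along the powers of `w⋆w`, the constant disappears in
the limit (`norm_le_of_norm_iterate_le`). Neither the gauge action nor a conditional expectation is
needed.
-/

/-! ### Norm estimates for powers in C⋆-algebras -/

section CStar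

variable {A : Type*} [NonUnitalCStarAlgebra A]

theorem iterate_mul_left_mul (x z : A) (k : ℕ) : (x * ·)^[k] x * z = (x * ·)^[k + 1] z := by
  induction k generalizing z with
  | zero => rfl
  | succ k ih =>
    rw [Function.iterate_succ_apply', mul_assoc, ih, ← Function.iterate_succ_apply' (x * ·)]

theorem isSelfAdjoint_iterate_mul_left {x : A} (hx : IsSelfAdjoint x) (k : ℕ) :
    IsSelfAdjoint ((x * ·)^[k] x) := by
  have hcomm : ∀ k : ℕ, (x * ·)^[k] x * x = x * (x * ·)^[k] x := fun k => by
    rw [iterate_mul_left_mul, Function.iterate_succ_apply']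
  induction k with
  | zero => exact hx
  | succ k ih =>
    rw [IsSelfAdjoint, Function.iterate_succ_apply', star_mul, ih.star_eq, hx.star_eq, hcomm]

/-- The norm of the power `x ^ (k + 1)` of a self-adjoint element; the power is written as an
iterated multiplication because the algebra need not have a unit. -/
theorem norm_iterate_mul_left {x : A} (hx : IsSelfAdjoint x) (k : ℕ) :
    ‖(x * ·)^[k] x‖ = ‖x‖ ^ (k + 1) := by
  have hle : ∀ k : ℕ, ‖(x * ·)^[k] x‖ ≤ ‖x‖ ^ (k + 1) := fun k => by
    induction k with
    | zero => simp
    | succ k ih =>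
      rw [Function.iterate_succ_apply', pow_succ']
      exact (norm_mul_le _ _).trans (mul_le_mul_of_nonneg_left ih (norm_nonneg _))
  -- the sequence of norms is logarithmically convex
  have hsq : ∀ k : ℕ, ‖(x * ·)^[k + 1] x‖ ^ 2 ≤ ‖(x * ·)^[k] x‖ * ‖(x * ·)^[k + 2] x‖ := by
    intro k
    have h1 := CStarRing.norm_star_mul_self (x := (x * ·)^[k + 1] x)
    rw [(isSelfAdjoint_iterate_mul_left hx _).star_eq, ← sq] at h1
    rw [← h1, iterate_mul_left_mul, ← Function.iterate_add_apply]
    have h2 : k + 1 + 1 + (k + 1) = k + 1 + (k + 2) := by ring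
    rw [h2, Function.iterate_add_apply, ← iterate_mul_left_mul]
    exact norm_mul_le _ _
  rcases (norm_nonneg x).eq_or_lt with h0 | h0
  · have := hle k
    rw [← h0, zero_pow (Nat.succ_ne_zero k)] at this ⊢
    exact le_antisymm this (norm_nonneg _)
  have hpos : ∀ k : ℕ, 0 < ‖(x * ·)^[k] x‖ ∧ ‖x‖ * ‖(x * ·)^[k] x‖ ≤ ‖(x * ·)^[k + 1] x‖ := by
    intro k
    induction k with
    | zero =>
      refine ⟨h0, ?_⟩
      have h1 := CStarRing.norm_star_mul_self (x := x)
      rw [hx.star_eq] at h1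
      exact h1.ge
    | succ k ih =>
      have h3 : 0 < ‖(x * ·)^[k + 1] x‖ := (mul_pos h0 ih.1).trans_le ih.2
      refine ⟨h3, le_of_mul_le_mul_left ?_ ih.1⟩
      refine le_trans ?_ (hsq k)
      nlinarith [mul_le_mul_of_nonneg_right ih.2 h3.le]
  refine le_antisymm (hle k) ?_
  induction k with
  | zero => simp
  | succ k ih =>
    rw [pow_succ']
    exact (mul_le_mul_of_nonneg_left ih h0.le).trans (hpos k).2

/-- A self-adjoint element `x` that leaves a subspace `R` invariant has norm at most `p` if it is
bounded by `p` on `R` and differs from an element of the closed right ideal generated by `R` by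
an element of norm at most `p`. -/
theorem norm_le_of_bounded_on_subspace {x y z : A} (hx : IsSelfAdjoint x) (hxyz : x = y + z)
    {R : Submodule ℂ A} {p : ℝ} (hp : 0 ≤ p) (hinv : ∀ ζ ∈ R, x * ζ ∈ R)
    (hb : ∀ ζ ∈ R, ‖x * ζ‖ ≤ p * ‖ζ‖) (hy : ‖y‖ ≤ p)
    (hz : z ∈ closure (Submodule.span ℂ {w | ∃ ζ ∈ R, ∃ b : A, w = ζ * b} : Set A)) :
    ‖x‖ ≤ p := by
  by_contra hlt
  have hlt := not_le.1 hlt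
  have hpos : 0 < ‖x‖ := hp.trans_lt hlt
  have hit : ∀ (k : ℕ) (ζ : A), ζ ∈ R → (x * ·)^[k] ζ ∈ R ∧ ‖(x * ·)^[k] ζ‖ ≤ p ^ k * ‖ζ‖ := by
    intro k ζ hζ
    induction k with
    | zero => simpa using hζ
    | succ k ih =>
      rw [Function.iterate_succ_apply']
      refine ⟨hinv _ ih.1, (hb _ ih.1).trans ?_⟩
      rw [pow_succ', mul_assoc]
      exact mul_le_mul_of_nonneg_left ih.2 hp
  have hmul : ∀ (k : ℕ) (a b : A), (x * ·)^[k] (a * b) = (x * ·)^[k] a * b := by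
    intro k a b
    induction k with
    | zero => rfl
    | succ k ih => rw [Function.iterate_succ_apply', ih, Function.iterate_succ_apply', mul_assoc]
  have hadd : ∀ (k : ℕ) (a b : A), (x * ·)^[k] (a + b) = (x * ·)^[k] a + (x * ·)^[k] b := by
    intro k a b
    induction k with
    | zero => rfl
    | succ k ih => simp only [Function.iterate_succ_apply', ih, mul_add]
  have hsmul : ∀ (k : ℕ) (c : ℂ) (b : A), (x * ·)^[k] (c • b) = c • (x * ·)^[k] b := by
    intro k a b
    induction k with
    | zero => rfl
    | succ k ih => simp only [Function.iterate_succ_apply', ih, mul_smul_comm]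
  have hnorm : ∀ (k : ℕ) (a : A), ‖(x * ·)^[k] a‖ ≤ ‖x‖ ^ k * ‖a‖ := by
    intro k a
    induction k with
    | zero => simp
    | succ k ih =>
      rw [Function.iterate_succ_apply', pow_succ', mul_assoc]
      exact (norm_mul_le _ _).trans (mul_le_mul_of_nonneg_left ih (norm_nonneg _))
  have hspan : ∀ w ∈ Submodule.span ℂ {w | ∃ ζ ∈ R, ∃ b : A, w = ζ * b},
      ∃ C : ℝ, ∀ k : ℕ, ‖(x * ·)^[k] w‖ ≤ p ^ k * C := by
    intro w hw
    induction hw using Submodule.span_induction with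
    | mem w h =>
      obtain ⟨ζ, hζ, b, rfl⟩ := h
      refine ⟨‖ζ‖ * ‖b‖, fun k => ?_⟩
      rw [hmul, ← mul_assoc]
      exact (norm_mul_le _ _).trans
        (mul_le_mul_of_nonneg_right (hit k ζ hζ).2 (norm_nonneg _))
    | zero =>
      refine ⟨0, fun k => ?_⟩
      have := hsmul k 0 0
      rw [zero_smul, zero_smul] at this
      simp [this]
    | add y z _ _ ihy ihz =>
      obtain ⟨C, hC⟩ := ihy
      obtain ⟨C', hC'⟩ := ihz
      refine ⟨C + C', fun k => ?_⟩
      rw [hadd, mul_add]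
      exact (norm_add_le _ _).trans (add_le_add (hC k) (hC' k))
    | smul a y _ ih =>
      obtain ⟨C, hC⟩ := ih
      refine ⟨‖a‖ * C, fun k => ?_⟩
      rw [hsmul, norm_smul, mul_left_comm]
      exact mul_le_mul_of_nonneg_left (hC k) (norm_nonneg _)
  obtain ⟨w, hw, hzw⟩ := Metric.mem_closure_iff.1 hz ((‖x‖ - p) / 2) (by linarith)
  obtain ⟨C, hC⟩ := hspan w hw
  have hkey : ∀ k : ℕ, ‖x‖ ^ k * ((‖x‖ - p) / 2) ≤ p ^ k * C := by
    intro k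
    have h1 : x = w + ((z - w) + y) := by rw [hxyz]; abel
    have h2 := norm_iterate_mul_left hx k
    have h3 : ‖(x * ·)^[k] x‖ ≤ p ^ k * C + ‖x‖ ^ k * ((‖x‖ - p) / 2 + p) := by
      nth_rewrite 2 [h1]
      rw [hadd]
      refine (norm_add_le _ _).trans (add_le_add (hC k) ((hnorm k _).trans ?_))
      refine mul_le_mul_of_nonneg_left ((norm_add_le _ _).trans (add_le_add ?_ hy)) (by positivity)
      rw [← dist_eq_norm]
      exact hzw.le
    rw [h2, pow_succ] at h3
    linarith
  have hlim : Filter.Tendsto (fun k : ℕ => (p / ‖x‖) ^ k * C) Filter.atTop (𝓝 (0 * C)) :=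
    (tendsto_pow_atTop_nhds_zero_of_lt_one (by positivity) ((div_lt_one hpos).2 hlt)).mul_const C
  rw [zero_mul] at hlim
  have := ge_of_tendsto' hlim (a := 0) (b := (‖x‖ - p) / 2) fun k => by
    have h4 := hkey k
    rw [div_pow, div_mul_eq_mul_div, le_div_iff₀ (by positivity)]
    linarith
  linarith

/-- If the norm of `x` is controlled by `c` with linearly growing constants on all powers of
`x`, then it is controlled by `c` with constant `1`. -/
theorem norm_le_of_norm_iterate_le {x : A} (hx : IsSelfAdjoint x) {a b c : ℝ} (hc : 0 ≤ c)
    (h : ∀ k : ℕ, ‖(x * ·)^[k] x‖ ≤ (a * k + b) * c ^ k) : ‖x‖ ≤ c := by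
  by_contra hlt
  have hlt := not_le.1 hlt
  have hpos : 0 < ‖x‖ := hc.trans_lt hlt
  have hr : |c / ‖x‖| < 1 := by
    rw [abs_of_nonneg (by positivity)]
    exact (div_lt_one hpos).2 hlt
  have h1 := (tendsto_pow_const_mul_const_pow_of_abs_lt_one 1 hr).const_mul a
  have h2 := (tendsto_pow_const_mul_const_pow_of_abs_lt_one 0 hr).const_mul b
  have h3 := h1.add h2
  simp only [mul_zero, add_zero, pow_one, pow_zero, one_mul] at h3
  have := ge_of_tendsto' h3 (b := ‖x‖) fun k => by
    have h4 := h k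
    rw [norm_iterate_mul_left hx] at h4
    have h5 : a * (↑k * (c / ‖x‖) ^ k) + b * (c / ‖x‖) ^ k = (a * k + b) * c ^ k / ‖x‖ ^ k := by
      rw [div_pow]
      ring
    rw [h5, le_div_iff₀ (by positivity), ← pow_succ']
    exact h4
  linarith

end CStar

namespace TopologicalGraph

noncomputable section

/-! ### Functions on the vertices and the edges -/

section Functions

variable {E0 E1 : Type u} [TopologicalSpace E0] [TopologicalSpace E1]

/-- A compactly supported continuous function with values in `[0, 1]`, as an element of `C₀`. -/
theorem exists_zeroAtInfty_eq_one {X : Type*} [TopologicalSpace X] [T2Space X]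
    [LocallyCompactSpace X] {K O : Set X} (hK : IsCompact K) (hO : IsOpen O) (hKO : K ⊆ O) :
    ∃ h : C₀(X, ℂ), (∀ v ∈ K, h v = 1) ∧ (∀ v, v ∉ O → h v = 0) ∧ ‖h‖ ≤ 1 := by
  obtain ⟨g, hg1, hgc, hgs, hg01⟩ := exists_continuousMap_one_of_isCompact_subset_isOpen hK hO hKO
  have hc : HasCompactSupport fun v => (g v : ℂ) := HasCompactSupport.comp_left
    (f := g) (g := fun t : ℝ => (t : ℂ)) hgc Complex.ofReal_zero
  refine ⟨⟨⟨fun v => (g v : ℂ), by fun_prop⟩, hc.is_zero_at_infty⟩, fun v hv => ?_, fun v hv => ?_,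
    norm_le_C0 zero_le_one fun v => ?_⟩
  · change (g v : ℂ) = 1
    rw [hg1 hv]
    simp
  · change (g v : ℂ) = 0
    rw [image_eq_zero_of_notMem_tsupport fun h => hv (hgs h)]
    simp
  · change ‖(g v : ℂ)‖ ≤ 1
    rw [Complex.norm_real, Real.norm_eq_abs, abs_of_nonneg (hg01 v).1]
    exact (hg01 v).2

/-- A function in `C₀(E⁰)` that is bounded by `p` off the regular vertices is the sum of a function
bounded by `p` and a function in `C₀(E⁰_rg)`. -/
theorem exists_add_mem_regularFunctions (E : TopologicalGraph E0 E1) {f : C₀(E0, ℂ)} {p : ℝ}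
    (hp : 0 ≤ p) (hf : ∀ v, v ∉ E.regularVertices → ‖f v‖ ≤ p) :
    ∃ g h : C₀(E0, ℂ), f = g + h ∧ ‖g‖ ≤ p ∧ h ∈ E.regularFunctions := by
  rcases hp.eq_or_lt with rfl | hp
  · exact ⟨0, f, by simp, by simp, fun v hv => norm_le_zero_iff.1 (hf v hv)⟩
  have hpos : ∀ v, 0 < max p ‖f v‖ := fun v => lt_max_of_lt_left hp
  have hfc : Continuous f := map_continuous f
  have hc : Continuous fun v => ((p / max p ‖f v‖ : ℝ) : ℂ) * f v := by
    refine (Complex.continuous_ofReal.comp ?_).mul hfc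
    exact continuous_const.div (continuous_const.max hfc.norm) fun v => (hpos v).ne'
  have hn : ∀ v, ‖((p / max p ‖f v‖ : ℝ) : ℂ) * f v‖ = p / max p ‖f v‖ * ‖f v‖ := fun v => by
    rw [norm_mul, Complex.norm_real, Real.norm_eq_abs, abs_of_nonneg (div_nonneg hp.le (hpos v).le)]
  let g : C₀(E0, ℂ) := ⟨⟨_, hc⟩, by
    refine squeeze_zero_norm (fun v => ?_) (by simpa using (zero_at_infty f).norm)
    change ‖((p / max p ‖f v‖ : ℝ) : ℂ) * f v‖ ≤ ‖f v‖
    rw [hn]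
    exact mul_le_of_le_one_left (norm_nonneg _) ((div_le_one (hpos v)).2 (le_max_left _ _))⟩
  have hg : ∀ v, g v = ((p / max p ‖f v‖ : ℝ) : ℂ) * f v := fun v => rfl
  refine ⟨g, f - g, by abel, norm_le_C0 hp.le fun v => ?_, fun v hv => ?_⟩
  · rw [hg, hn, div_mul_eq_mul_div, div_le_iff₀ (hpos v)]
    exact mul_le_mul_of_nonneg_left (le_max_right _ _) hp.le
  · rw [ZeroAtInftyContinuousMap.sub_apply, hg, max_eq_left (hf v hv), div_self hp.ne']
    simp

variable {E : TopologicalGraph E0 E1} [T2Space E1]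

theorem Cd.hasCompactSupport_leftAction {ξ : E.Cd} (hξ : HasCompactSupport ξ) (f : C₀(E0, ℂ)) :
    HasCompactSupport (E.leftAction f ξ) :=
  HasCompactSupport.mul_left (f := fun e => f (E.r e)) hξ

theorem Cd.exists_rightMul_eq_self [T2Space E0] [LocallyCompactSpace E0] {ξ : E.Cd}
    (hξ : HasCompactSupport ξ) : ∃ h : C₀(E0, ℂ), ξ.rightMul h = ξ := by
  obtain ⟨h, h1, -, -⟩ := exists_zeroAtInfty_eq_one
    (hξ.isCompact.image E.isLocalHomeomorph_d.continuous) isOpen_univ (Set.subset_univ _)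
  refine ⟨h, Cd.ext fun e => ?_⟩
  rw [Cd.rightMul_apply]
  by_cases he : ξ e = 0
  · rw [he, zero_mul]
  · rw [h1 _ ⟨e, subset_tsupport ξ he, rfl⟩, mul_one]

/-- A bump function near the edge `e`. The last clause says that compressing `f` by it transports
the value of `f` at `r(e)` to `d(e)`; it holds because `d` is injective on the support. -/
theorem Cd.exists_bump [T2Space E0] [LocallyCompactSpace E1] {e : E1} {O : Set E1} (hO : IsOpen O)
    (he : e ∈ O) : ∃ ζ : E.Cd, HasCompactSupport ζ ∧ (∀ e', e' ∉ O → ζ e' = 0) ∧ ‖ζ‖ ≤ 1 ∧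
      ∀ f : C₀(E0, ℂ), Cd.ip ζ (E.leftAction f ζ) (E.d e) = f (E.r e) := by
  obtain ⟨φ, hφ, hdφ⟩ := E.isLocalHomeomorph_d e
  obtain ⟨g, hg1, hgc, hgs, hg01⟩ := exists_continuousMap_one_of_isCompact_subset_isOpen
    (isCompact_singleton (x := e)) (hO.inter φ.open_source)
    (Set.singleton_subset_iff.2 ⟨he, hφ⟩)
  have hge : g e = 1 := hg1 rfl
  have hsq : tsupport (fun e => ‖(g e : ℂ)‖ ^ 2) ⊆ tsupport g :=
    closure_mono fun x hx hgx => hx (by simp [show g x = 0 from hgx])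
  let ζ : E.Cd := Cd.mk (fun e => (g e : ℂ)) (by fun_prop)
    (E.hasC0FibreSum_of_hasCompactSupport (by fun_prop)
      (hgc.of_isClosed_subset (isClosed_tsupport _) hsq) hdφ
      (hsq.trans (hgs.trans Set.inter_subset_right)))
  have hζ : ∀ x, ζ x = (g x : ℂ) := fun x => rfl
  have hζ0 : ∀ x, ζ x ≠ 0 → x ∈ O ∩ φ.source := fun x hx =>
    hgs (subset_tsupport g fun h => hx (by rw [hζ, h, Complex.ofReal_zero]))
  have huniq : ∀ x y, ζ x ≠ 0 → ζ y ≠ 0 → E.d x = E.d y → x = y := fun x y hx hy hxy =>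
    φ.injOn (hζ0 x hx).2 (hζ0 y hy).2 (by rw [← hdφ]; exact hxy)
  refine ⟨ζ, HasCompactSupport.comp_left (f := g) (g := fun t : ℝ => (t : ℂ)) hgc
    Complex.ofReal_zero, fun x hx => by_contra fun h => hx (hζ0 x h).1,
    Cd.norm_le zero_le_one fun v => ?_, fun f => ?_⟩
  · refine le_of_sq_le_sq ?_ zero_le_one
    rw [one_pow]
    by_cases hv : ∃ x : E.Fib v, ζ x ≠ 0
    · obtain ⟨x, hx⟩ := hv
      have h1 := hasSum_single x (f := fun e : E.Fib v => ‖ζ e‖ ^ 2) fun y hy => by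
        by_contra hne
        exact hy (Subtype.ext (huniq _ _ (fun h => hne (by simp [h])) hx (y.2.trans x.2.symm)))
      rw [(Cd.hasSum_fib v ζ).unique h1, hζ, Complex.norm_real, Real.norm_eq_abs,
        abs_of_nonneg (hg01 _).1]
      exact pow_le_one₀ (hg01 _).1 (hg01 _).2
    · push Not at hv
      have h1 : (fun e : E.Fib v => ‖ζ e‖ ^ 2) = fun _ => 0 := by
        funext x
        simp [hv x]
      have h2 := Cd.hasSum_fib v ζ
      rw [h1] at h2
      rw [h2.unique hasSum_zero]
      exact zero_le_one
  · rw [Cd.ip_apply, tsum_eq_single (⟨e, rfl⟩ : E.Fib (E.d e))]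
    · simp [hζ, hge]
    · intro y hy
      by_cases h : ζ y = 0
      · simp [h]
      · exact absurd (Subtype.ext (huniq y e h (by simp [hζ, hge]) y.2)) hy

/-- The compactly supported functions are dense in `C_d(E¹)`. -/
theorem Cd.exists_hasCompactSupport_norm_sub_le [LocallyCompactSpace E1] (ξ : E.Cd) {ε : ℝ}
    (hε : 0 < ε) : ∃ η : E.Cd, HasCompactSupport η ∧ ‖ξ - η‖ ≤ ε := by
  classical
  -- a cutoff `χ` for which the fibre sum of `(1 - χ) |ξ|²` is small at a given vertex
  have hloc : ∀ v : E0, ∃ χ : C(E1, ℝ), HasCompactSupport χ ∧ (∀ e, χ e ∈ Set.Icc (0 : ℝ) 1) ∧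
      ∀ᶠ w in 𝓝 v, ∃ s < ε ^ 2, HasSum (fun e : E.Fib w => (1 - χ e) * ‖ξ e‖ ^ 2) s := by
    intro v
    have hs := Cd.hasSum_fib v ξ
    obtain ⟨s, hs1⟩ : ∃ s : Finset (E.Fib v), ‖Cd.fib v ξ‖ ^ 2 - ε ^ 2 < ∑ e ∈ s, ‖ξ e‖ ^ 2 :=
      (hs.eventually (lt_mem_nhds (sub_lt_self _ (by positivity)))).exists
    obtain ⟨χ, hχ1, hχc, -, hχ01⟩ := exists_continuousMap_one_of_isCompact_subset_isOpen
      (s.image (fun e : E.Fib v => (e : E1))).finite_toSet.isCompact isOpen_univ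
      (Set.subset_univ _)
    have hξc := ξ.continuous
    obtain ⟨h, hh⟩ := HasC0FibreSum.mono E ξ.hasC0FibreSum (hξc.norm.pow 2)
      (g := fun e => (1 - χ e) * ‖ξ e‖ ^ 2) (by fun_prop)
      (fun e => mul_nonneg (sub_nonneg.2 (hχ01 e).2) (by positivity))
      (fun e => mul_le_of_le_one_left (by positivity) (by linarith [(hχ01 e).1]))
    refine ⟨χ, hχc, hχ01, ?_⟩
    have hv : h v < ε ^ 2 := by
      have h1 := hs.sub (hh v)
      have h2 : ∑ e ∈ s, ‖ξ e‖ ^ 2 ≤ ‖Cd.fib v ξ‖ ^ 2 - h v := by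
        refine le_trans (Finset.sum_le_sum fun e he => ?_) (sum_le_hasSum s (fun e _ => ?_) h1)
        · have h3 : χ e = 1 := hχ1 (Finset.mem_coe.2 (Finset.mem_image_of_mem _ he))
          simp [h3]
        · have h4 := (hχ01 e).1
          have h5 : ‖ξ e‖ ^ 2 - (1 - χ e) * ‖ξ e‖ ^ 2 = χ e * ‖ξ e‖ ^ 2 := by ring
          rw [h5]
          positivity
      linarith
    filter_upwards [(map_continuous h).continuousAt.eventually (gt_mem_nhds hv)] with w hw
    exact ⟨h w, hw, hh w⟩
  choose χ hχc hχ01 hχs using hloc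
  obtain ⟨a, ha⟩ := ξ.exists_norm_fib
  have hK : ∀ᶠ v in Filter.cocompact E0, a v < ε ^ 2 :=
    (zero_at_infty a).eventually (gt_mem_nhds (by positivity))
  obtain ⟨K, hKc, hK⟩ := Filter.mem_cocompact.1 hK
  obtain ⟨t, -, hcov⟩ := hKc.elim_nhds_subcover
    (fun v => {w | ∃ s < ε ^ 2, HasSum (fun e : E.Fib w => (1 - χ v e) * ‖ξ e‖ ^ 2) s})
    fun v _ => hχs v
  have hP01 : ∀ e, ∏ v ∈ t, (1 - χ v e) ∈ Set.Icc (0 : ℝ) 1 := fun e =>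
    ⟨Finset.prod_nonneg fun v _ => sub_nonneg.2 (hχ01 v e).2,
      Finset.prod_le_one (fun v _ => sub_nonneg.2 (hχ01 v e).2)
        fun v _ => by linarith [(hχ01 v e).1]⟩
  let g : E1 →ᵇ ℂ := BoundedContinuousFunction.ofNormedAddCommGroup
    (fun e => ((1 - ∏ v ∈ t, (1 - χ v e) : ℝ) : ℂ)) (by fun_prop) 1 fun e => by
      rw [Complex.norm_real, Real.norm_eq_abs, abs_of_nonneg (by linarith [(hP01 e).2])]
      linarith [(hP01 e).1]
  have hg : ∀ e, g e = ((1 - ∏ v ∈ t, (1 - χ v e) : ℝ) : ℂ) := fun e => rfl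
  refine ⟨mulOp g ξ, ?_, Cd.norm_le hε.le fun w => ?_⟩
  · refine HasCompactSupport.intro (t.isCompact_biUnion fun v _ => (hχc v).isCompact) fun e he => ?_
    have h0 : ∀ v ∈ t, 1 - χ v e = 1 := fun v hv => by
      rw [image_eq_zero_of_notMem_tsupport fun h => he (Set.mem_iUnion₂.2 ⟨v, hv, h⟩), sub_zero]
    rw [mulOp_apply, hg, Finset.prod_congr rfl h0]
    simp
  · refine le_of_sq_le_sq ?_ hε.le
    have hval : ∀ e, ‖(ξ - mulOp g ξ) e‖ ^ 2 = (∏ v ∈ t, (1 - χ v e)) ^ 2 * ‖ξ e‖ ^ 2 := by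
      intro e
      have h6 : (ξ - mulOp g ξ) e = ((∏ v ∈ t, (1 - χ v e) : ℝ) : ℂ) * ξ e := by
        rw [Cd.sub_apply, mulOp_apply, hg]
        push_cast
        ring
      rw [h6, norm_mul, mul_pow, Complex.norm_real, Real.norm_eq_abs, sq_abs]
    have hsum := Cd.hasSum_fib w (ξ - mulOp g ξ)
    simp_rw [hval] at hsum
    have hle1 : ∀ e, (∏ v ∈ t, (1 - χ v e)) ^ 2 ≤ 1 := fun e =>
      pow_le_one₀ (hP01 e).1 (hP01 e).2
    by_cases hw : w ∈ K
    · obtain ⟨v, hv, s, hs, hsw⟩ := Set.mem_iUnion₂.1 (hcov hw)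
      refine le_trans (hasSum_le (fun e => ?_) hsum hsw) hs.le
      refine mul_le_mul_of_nonneg_right ?_ (by positivity)
      have h7 : ∏ u ∈ t, (1 - χ u e) ≤ 1 - χ v e := by
        rw [← Finset.mul_prod_erase t _ hv]
        refine mul_le_of_le_one_right (sub_nonneg.2 (hχ01 v e).2) ?_
        exact Finset.prod_le_one (fun v _ => sub_nonneg.2 (hχ01 v e).2)
          fun v _ => by linarith [(hχ01 v e).1]
      have h8 := hP01 (e : E1)
      nlinarith [h8.1, h8.2]
    · have h9 : ‖Cd.fib w ξ‖ ^ 2 < ε ^ 2 := by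
        rw [ha]
        exact hK hw
      refine le_trans (hasSum_le (fun e => ?_) hsum (Cd.hasSum_fib w ξ)) h9.le
      exact mul_le_of_le_one_left (by positivity) (hle1 e)

end Functions

/-! ### Paths in a topologically free graph -/

section Paths

variable {E0 E1 : Type u} [TopologicalSpace E0] [TopologicalSpace E1]

/-- `E.Walk x l y`: the list `l = [e₁, …, eₘ]` of edges is a path with range `x = r(e₁)` and domain
`y = d(eₘ)`, traversed from its range backwards, so that `d(eᵢ) = r(eᵢ₊₁)`. The empty list is a
path from each vertex to itself. -/
def Walk (E : TopologicalGraph E0 E1) : E0 → List E1 → E0 → Prop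
  | x, [], y => x = y
  | x, e :: l, y => E.r e = x ∧ Walk E (E.d e) l y

variable {E : TopologicalGraph E0 E1}

theorem walk_append {x z : E0} {l m : List E1} :
    E.Walk x (l ++ m) z ↔ ∃ y, E.Walk x l y ∧ E.Walk y m z := by
  induction l generalizing x with
  | nil => simp [Walk]
  | cons e l ih => simp only [List.cons_append, Walk, ih]; tauto

theorem walk_singleton {x y : E0} {e : E1} : E.Walk x [e] y ↔ E.r e = x ∧ E.d e = y := Iff.rfl

/-- A path can be cut in front of any of its edges. -/
theorem walk_split {x z : E0} {l m : List E1} {e : E1} (h : E.Walk x (l ++ e :: m) z) :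
    E.Walk x l (E.r e) ∧ E.Walk (E.r e) (e :: m) z := by
  obtain ⟨y, h1, h2⟩ := walk_append.1 h
  obtain rfl := h2.1
  exact ⟨h1, h2⟩

/-- A closed walk without entrances, rewritten as a loop in the sense of `IsLoop`. The order of the
edges is reversed, since `IsLoop` lists them from the domain to the range. -/
theorem isLoop_of_walk {v : E0} {l : List E1} (hl : l ≠ []) (h : E.Walk v l v)
    (hent : ∀ a ∈ l, ∀ e, E.r e = E.r a → e = a) :
    ∃ (n : ℕ) (p : Fin (n + 1) → E1), E.IsLoop p ∧ E.IsWithoutEntrances p ∧ E.d (p 0) = v := by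
  have hchain : ∀ (l : List E1) (x y : E0), E.Walk x l y → ∀ (i : ℕ) (hi : i + 1 < l.length),
      E.d (l[i]) = E.r (l[i + 1]) := by
    intro l
    induction l with
    | nil => intro x y _ i hi; simp at hi
    | cons a l ih =>
      intro x y h i hi
      cases i with
      | zero =>
        cases l with
        | nil => simp at hi
        | cons b l => exact h.2.1.symm
      | succ i => exact ih _ _ h.2 i (by simpa using hi)
  have hlast : ∀ (l : List E1) (x y : E0) (hl : l ≠ []), E.Walk x l y → E.d (l.getLast hl) = y := by
    intro l
    induction l with
    | nil => intro x y hl; exact absurd rfl hl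
    | cons a l ih =>
      intro x y _ h
      cases l with
      | nil => exact h.2
      | cons b l => exact ih _ _ (by simp) h.2
  obtain ⟨a, t, rfl⟩ := List.exists_cons_of_ne_nil hl
  refine ⟨t.length, fun k => (a :: t)[t.length - k]'(by rw [List.length_cons]; omega), ⟨fun k => ?_, ?_⟩,
    fun k => ?_, ?_⟩
  · have hk := k.2
    have h1 := hchain _ _ _ h (t.length - (k + 1)) (by simp; omega)
    have h2 : t.length - (k + 1) + 1 = t.length - k := by omega
    simpa [h2] using h1
  · have h1 := hlast _ _ _ hl h
    rw [List.getLast_eq_getElem] at h1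
    have h2 : E.r a = v := h.1
    simp only [Fin.val_last, Nat.sub_self, List.getElem_cons_zero, Fin.val_zero, Nat.sub_zero]
    rw [h2]
    simpa using h1.symm
  · ext e
    exact ⟨fun he => hent _ (List.getElem_mem _) e he, fun he => by rw [he]; rfl⟩
  · have h1 := hlast _ _ _ hl h
    rw [List.getLast_eq_getElem] at h1
    simpa using h1

/-- The set of vertices reached from `V` by paths of length `n` is open. -/
theorem isOpen_walk {V : Set E0} (hV : IsOpen V) (n : ℕ) :
    IsOpen {y | ∃ x ∈ V, ∃ l, l.length = n ∧ E.Walk x l y} := by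
  induction n with
  | zero =>
    convert hV using 1
    ext y
    simp [Walk]
  | succ n ih =>
    convert E.isLocalHomeomorph_d.isOpenMap _ (ih.preimage E.continuous_r) using 1
    ext y
    constructor
    · rintro ⟨x, hx, l, hl, h⟩
      obtain ⟨m, e, rfl⟩ := (List.eq_nil_or_concat l).resolve_left (by rintro rfl; simp at hl)
      obtain ⟨z, h1, h2⟩ := walk_append.1 (List.concat_eq_append ▸ h)
      obtain ⟨rfl, rfl⟩ := walk_singleton.1 h2
      exact ⟨e, ⟨x, hx, m, by simpa using hl, h1⟩, rfl⟩
    · rintro ⟨e, ⟨x, hx, l, hl, h⟩, rfl⟩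
      exact ⟨x, hx, l ++ [e], by simp [hl], walk_append.2 ⟨_, h, rfl, rfl⟩⟩

/-- A regular vertex receives an edge: otherwise the compact set `r(r⁻¹(V))` could be removed from a
neighbourhood `V` of it, and it would be a source. -/
theorem exists_range_eq [T2Space E0] [LocallyCompactSpace E0] {v : E0}
    (hv : v ∈ E.regularVertices) : ∃ e, E.r e = v := by
  by_contra hne
  push Not at hne
  obtain ⟨⟨V, hV, hVc⟩, hv2⟩ := hv
  have hcl : IsClosed (E.r '' (E.r ⁻¹' V)) := (hVc.image E.continuous_r).isClosed
  have hmem : v ∉ E.r '' (E.r ⁻¹' V) := by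
    rintro ⟨e, -, he⟩
    exact hne e he
  refine hv2 (subset_closure ?_)
  intro hvc
  obtain ⟨_, ⟨hw1, hw2⟩, e, rfl⟩ := mem_closure_iff_nhds.1 hvc _
    (Filter.inter_mem hV (hcl.isOpen_compl.mem_nhds hmem))
  exact hw2 ⟨e, hw1, rfl⟩

/-- From any vertex of a closed walk `c` there are arbitrarily long walks along `c` to any other
vertex of `c`. -/
theorem exists_long_walk {v : E0} {c : List E1} (hc : E.Walk v c v) {a b : E1} (ha : a ∈ c)
    (hb : b ∈ c) (N : ℕ) : ∃ l, N ≤ l.length ∧ (∀ e ∈ l, e ∈ c) ∧ E.Walk (E.r a) l (E.r b) := by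
  obtain ⟨a1, a2, ha'⟩ := List.append_of_mem ha
  obtain ⟨b1, b2, hb'⟩ := List.append_of_mem hb
  have h1 := (walk_split (ha' ▸ hc)).2
  have h2 := (walk_split (hb' ▸ hc)).1
  have h3 : ∀ n : ℕ, ∃ l, n ≤ l.length ∧ (∀ e ∈ l, e ∈ c) ∧ E.Walk v l v := by
    intro n
    induction n with
    | zero => exact ⟨[], by simp, by simp, rfl⟩
    | succ n ih =>
      obtain ⟨l, hl1, hl2, hl3⟩ := ih
      refine ⟨c ++ l, ?_, ?_, walk_append.2 ⟨_, hc, hl3⟩⟩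
      · have := List.length_pos_of_mem ha
        rw [List.length_append]
        omega
      · intro e he
        exact (List.mem_append.1 he).elim id (hl2 e)
  obtain ⟨l, hl1, hl2, hl3⟩ := h3 N
  refine ⟨(a :: a2) ++ (l ++ b1), ?_, ?_, walk_append.2 ⟨_, h1, walk_append.2 ⟨_, hl3, h2⟩⟩⟩
  · simp only [List.length_append]
    omega
  · intro e he
    rcases List.mem_append.1 he with he | he
    · rw [ha']
      exact List.mem_append_right _ he
    · rcases List.mem_append.1 he with he | he
      · exact hl2 e he
      · rw [hb']
        exact List.mem_append_left _ he

/-- In a topologically free graph, from every nonempty open set one can walk to a singular vertex,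
or there are arbitrarily long walks whose last edge occurs only once. -/
theorem TopologicallyFree.exists_walk [T2Space E0] [LocallyCompactSpace E0]
    (hE : E.TopologicallyFree) {V : Set E0} (hV : IsOpen V) (hne : V.Nonempty) (N : ℕ) :
    (∃ x ∈ V, ∃ l y, E.Walk x l y ∧ y ∉ E.regularVertices) ∨
      ∃ x ∈ V, ∃ l e y, E.Walk x (l ++ [e]) y ∧ N ≤ l.length ∧ e ∉ l := by
  classical
  by_contra! hcon
  obtain ⟨hreg, hret⟩ := hcon
  have hstep : ∀ n, {y | ∃ x ∈ V, ∃ l, l.length = n ∧ E.Walk x l y}.Nonempty := by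
    intro n
    induction n with
    | zero =>
      obtain ⟨x, hx⟩ := hne
      exact ⟨x, x, hx, [], rfl, rfl⟩
    | succ n ih =>
      obtain ⟨y, x, hx, l, hl, h⟩ := ih
      obtain ⟨e, he⟩ := exists_range_eq (hreg x hx l y h)
      exact ⟨E.d e, x, hx, l ++ [e], by simp [hl], walk_append.2 ⟨_, h, he, rfl⟩⟩
  obtain ⟨v, ⟨x, hx, μ, hμ, hxv⟩, hvbase⟩ : ∃ v ∈ {y | ∃ x ∈ V, ∃ l, l.length = N ∧ E.Walk x l y},
      ¬ ∃ (n : ℕ) (p : Fin (n + 1) → E1), E.IsLoop p ∧ E.IsWithoutEntrances p ∧ E.d (p 0) = v := by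
    by_contra! h
    obtain ⟨v, hv⟩ := hstep N
    exact (Set.eq_empty_iff_forall_notMem.1 hE v) (mem_interior.2 ⟨_, h, isOpen_walk hV N, hv⟩)
  obtain ⟨e₀, he₀⟩ := exists_range_eq (hreg x hx μ v hxv)
  have hmem := hret x hx μ e₀ (E.d e₀) (walk_append.2 ⟨v, hxv, he₀, rfl⟩) hμ.ge
  -- `v` lies on a closed walk; a shortest one meets each of its vertices only once
  have hloop : ∃ n, ∃ c : List E1, c.length = n ∧ c ≠ [] ∧ E.Walk v c v := by
    obtain ⟨l1, l2, rfl⟩ := List.append_of_mem hmem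
    have h1 := (walk_split hxv).2
    rw [he₀] at h1
    exact ⟨_, _, rfl, List.cons_ne_nil _ _, h1⟩
  obtain ⟨c, hcl, hc0, hc⟩ := Nat.find_spec hloop
  have hmin : ∀ c' : List E1, c' ≠ [] → E.Walk v c' v → c.length ≤ c'.length := fun c' h1 h2 => by
    rw [hcl]
    exact Nat.find_min' hloop ⟨c', rfl, h1, h2⟩
  have hcut : ∀ l1 a l2 b l3, c = l1 ++ a :: (l2 ++ b :: l3) → E.r a ≠ E.r b := by
    rintro l1 a l2 b l3 h hab
    have h1 := walk_split (h ▸ hc)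
    have h2 := walk_split (l := a :: l2) h1.2
    have h3 := hmin (l1 ++ b :: l3) (by simp) (walk_append.2 ⟨_, h1.1, hab ▸ h2.2⟩)
    rw [h] at h3
    simp only [List.length_append, List.length_cons] at h3
    omega
  have hinj : ∀ a ∈ c, ∀ b ∈ c, E.r a = E.r b → a = b := by
    intro a ha b hb hab
    by_contra hne
    obtain ⟨l1, l2, h⟩ := List.append_of_mem ha
    rw [h, List.mem_append, List.mem_cons] at hb
    rcases hb with hb | hb | hb
    · obtain ⟨l3, l4, rfl⟩ := List.append_of_mem hb
      exact hcut l3 b l4 a l2 (by simpa using h) hab.symm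
    · exact hne hb.symm
    · obtain ⟨l3, l4, rfl⟩ := List.append_of_mem hb
      exact hcut l1 a l3 b l4 h hab
  -- this closed walk has an entrance `e`, which is not one of its edges
  obtain ⟨b, hb, e, heb, hne'⟩ : ∃ b ∈ c, ∃ e, E.r e = E.r b ∧ e ≠ b := by
    by_contra! h
    exact hvbase (isLoop_of_walk hc0 hc h)
  have hec : e ∉ c := fun h => hne' (hinj e h b hb heb)
  -- a shortest walk from `V` to the closed walk does not pass through `e` either
  have happ : ∃ n, ∃ x ∈ V, ∃ l : List E1, l.length = n ∧ ∃ a ∈ c, E.Walk x l (E.r a) := by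
    obtain ⟨a, t, rfl⟩ := List.exists_cons_of_ne_nil hc0
    exact ⟨_, x, hx, μ, rfl, a, by simp, hc.1 ▸ hxv⟩
  obtain ⟨x', hx', l, hl, a, ha, hw⟩ := Nat.find_spec happ
  have hel : e ∉ l := by
    intro he
    obtain ⟨l1, l2, rfl⟩ := List.append_of_mem he
    have h1 := Nat.find_min' happ ⟨x', hx', l1, rfl, b, hb, heb ▸ (walk_split hw).1⟩
    rw [← hl] at h1
    simp at h1
  obtain ⟨m, hm1, hm2, hm3⟩ := exists_long_walk hc ha hb N
  refine absurd (hret x' hx' (l ++ m) e (E.d e)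
    (walk_append.2 ⟨_, walk_append.2 ⟨_, hw, hm3⟩, heb, rfl⟩) ?_) ?_
  · rw [List.length_append]
    omega
  · intro h
    exact (List.mem_append.1 h).elim hel fun h => hec (hm2 e h)

end Paths

/-! ### Monomials and their degrees -/

section Monomials

variable {E0 E1 : Type u} [TopologicalSpace E0] [TopologicalSpace E1] [T2Space E1]
  {E : TopologicalGraph E0 E1} {B : Type v} [NonUnitalCStarAlgebra B]

namespace ToeplitzPair

variable (S : E.ToeplitzPair B)

theorem star_T0 (f : C₀(E0, ℂ)) : star (S.T0 f) = S.T0 (star f) := (map_star S.T0 f).symm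

theorem star_T1_mul_T0 (ξ : E.Cd) (f : C₀(E0, ℂ)) :
    star (S.T1 ξ) * S.T0 f = star (S.T1 (E.leftAction (star f) ξ)) := by
  rw [← S.T0_mul_T1, star_mul, S.star_T0, star_star]

/-- `S.IsMonomial a b x`: the element `x` is a product
`T¹(ξ₁) ⋯ T¹(ξₐ) T⁰(f) T¹(η_b)⋆ ⋯ T¹(η₁)⋆` with compactly supported `ξᵢ` and `ηⱼ`. -/
inductive IsMonomial : ℕ → ℕ → B → Prop
  | T0 (f : C₀(E0, ℂ)) : IsMonomial 0 0 (S.T0 f)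
  | left {a b : ℕ} {x : B} (ξ : E.Cd) (hξ : HasCompactSupport ξ) (hx : IsMonomial a b x) :
      IsMonomial (a + 1) b (S.T1 ξ * x)
  | right {a b : ℕ} {x : B} (ξ : E.Cd) (hξ : HasCompactSupport ξ) (hx : IsMonomial a b x) :
      IsMonomial a (b + 1) (x * star (S.T1 ξ))

variable {S}

theorem IsMonomial.adjoint {a b : ℕ} {x : B} (h : S.IsMonomial a b x) :
    S.IsMonomial b a (star x) := by
  induction h with
  | T0 f => rw [S.star_T0]; exact .T0 _
  | left ξ hξ _ ih => rw [star_mul]; exact .right ξ hξ ih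
  | right ξ hξ _ ih => rw [star_mul, star_star]; exact .left ξ hξ ih

theorem IsMonomial.exists_left {a b : ℕ} {x : B} (h : S.IsMonomial (a + 1) b x) :
    ∃ (ξ : E.Cd) (y : B), HasCompactSupport ξ ∧ S.IsMonomial a b y ∧ x = S.T1 ξ * y := by
  generalize hn : a + 1 = n at h
  induction h with
  | T0 f => omega
  | left ξ hξ hx _ =>
    obtain rfl := Nat.succ_injective hn
    exact ⟨ξ, _, hξ, hx, rfl⟩
  | right ξ hξ _ ih =>
    obtain ⟨η, y, hη, hy, rfl⟩ := ih hn
    exact ⟨η, _, hη, .right ξ hξ hy, mul_assoc _ _ _⟩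

theorem IsMonomial.exists_right {a b : ℕ} {x : B} (h : S.IsMonomial a (b + 1) x) :
    ∃ (ξ : E.Cd) (y : B), HasCompactSupport ξ ∧ S.IsMonomial a b y ∧ x = y * star (S.T1 ξ) := by
  obtain ⟨ξ, y, hξ, hy, hx⟩ := h.adjoint.exists_left
  exact ⟨ξ, star y, hξ, hy.adjoint, by rw [← star_star x, hx, star_mul]⟩

theorem IsMonomial.exists_T0 {x : B} (h : S.IsMonomial 0 0 x) : ∃ f, x = S.T0 f := by
  cases h with
  | T0 f => exact ⟨f, rfl⟩

theorem IsMonomial.T0_mul {a b : ℕ} {x : B} (h : S.IsMonomial a b x) (f : C₀(E0, ℂ)) :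
    S.IsMonomial a b (S.T0 f * x) := by
  induction h with
  | T0 g => rw [← map_mul]; exact .T0 _
  | left ξ hξ hx _ =>
    rw [← mul_assoc, S.T0_mul_T1]
    exact .left _ (Cd.hasCompactSupport_leftAction hξ f) hx
  | right ξ hξ _ ih => rw [← mul_assoc]; exact .right ξ hξ ih

theorem IsMonomial.star_T1_mul {a b : ℕ} {x : B} (h : S.IsMonomial (a + 1) b x) (ξ : E.Cd) :
    S.IsMonomial a b (star (S.T1 ξ) * x) := by
  obtain ⟨η, y, -, hy, rfl⟩ := h.exists_left
  rw [← mul_assoc, S.star_T1_mul_T1]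
  exact hy.T0_mul _

theorem IsMonomial.mul_T1 {a b : ℕ} {x : B} (h : S.IsMonomial a (b + 1) x) (ξ : E.Cd) :
    S.IsMonomial a b (x * S.T1 ξ) := by
  have := (h.adjoint.star_T1_mul ξ).adjoint
  rwa [star_mul, star_star, star_star] at this

variable [T2Space E0] [LocallyCompactSpace E0]

theorem isMonomial_T1 {ξ : E.Cd} (hξ : HasCompactSupport ξ) : S.IsMonomial 1 0 (S.T1 ξ) := by
  obtain ⟨h, hh⟩ := Cd.exists_rightMul_eq_self hξ
  rw [← hh, ← S.T1_mul_T0]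
  exact .left ξ hξ (.T0 h)

theorem IsMonomial.star_T1_mul_zero {b : ℕ} {x : B} (h : S.IsMonomial 0 b x) {ξ : E.Cd}
    (hξ : HasCompactSupport ξ) : S.IsMonomial 0 (b + 1) (star (S.T1 ξ) * x) := by
  generalize hn : 0 = n at h
  induction h with
  | T0 f =>
    rw [S.star_T1_mul_T0]
    exact (isMonomial_T1 (Cd.hasCompactSupport_leftAction hξ _)).adjoint
  | left => omega
  | right η hη _ ih => rw [← mul_assoc]; exact .right η hη (ih hn)

/-- The product of two monomials is a monomial, after the inner factors have been cancelled. -/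
theorem IsMonomial.mul {a b c d : ℕ} {x y : B} (hx : S.IsMonomial a b x)
    (hy : S.IsMonomial c d y) : S.IsMonomial (a + (c - b)) (d + (b - c)) (x * y) := by
  induction hx generalizing c d y with
  | T0 f => simpa using hy.T0_mul f
  | @left a b x ξ hξ _ ih =>
    rw [mul_assoc, Nat.add_right_comm]
    exact .left ξ hξ (ih hy)
  | @right a b x ξ hξ _ ih =>
    rw [mul_assoc]
    cases c with
    | zero =>
      convert ih (hy.star_T1_mul_zero hξ) using 1 <;> omega
    | succ c =>
      convert ih (hy.star_T1_mul ξ) using 1 <;> omega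

variable (S)

/-- The span of the monomials of degree `k`. -/
def homogeneous (k : ℤ) : Submodule ℂ B :=
  Submodule.span ℂ {x | ∃ a b : ℕ, S.IsMonomial a b x ∧ (a : ℤ) - b = k}

/-- The span of the monomials of nonzero degree. -/
def offDegreeZero : Submodule ℂ B :=
  Submodule.span ℂ {x | ∃ a b : ℕ, S.IsMonomial a b x ∧ a ≠ b}

/-- The span of the monomials with `a = b ≤ n`; the closure of the union of these spaces is the
core of `C⋆(S)`. -/
def core (n : ℕ) : Submodule ℂ B :=
  Submodule.span ℂ {x | ∃ a ≤ n, S.IsMonomial a a x}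

variable {S}

omit [T2Space E0] [LocallyCompactSpace E0] in
theorem homogeneous_le_offDegreeZero {k : ℤ} (hk : k ≠ 0) : S.homogeneous k ≤ S.offDegreeZero :=
  Submodule.span_mono fun _ ⟨a, b, h, hab⟩ => ⟨a, b, h, by omega⟩

omit [T2Space E0] [LocallyCompactSpace E0] in
theorem core_le_homogeneous (n : ℕ) : S.core n ≤ S.homogeneous 0 :=
  Submodule.span_mono fun _ ⟨a, _, h⟩ => ⟨a, a, h, by omega⟩

omit [T2Space E0] [LocallyCompactSpace E0] in
theorem core_mono {m n : ℕ} (h : m ≤ n) : S.core m ≤ S.core n :=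
  Submodule.span_mono fun _ ⟨a, ha, hx⟩ => ⟨a, ha.trans h, hx⟩

theorem mul_mem_span_of_forall {s t r : Set B}
    (h : ∀ x ∈ s, ∀ y ∈ t, x * y ∈ Submodule.span ℂ r) {x y : B} (hx : x ∈ Submodule.span ℂ s)
    (hy : y ∈ Submodule.span ℂ t) : x * y ∈ Submodule.span ℂ r := by
  induction hx using Submodule.span_induction with
  | mem x hxs =>
    induction hy using Submodule.span_induction with
    | mem y hyt => exact h x hxs y hyt
    | zero => rw [mul_zero]; exact Submodule.zero_mem _
    | add y z _ _ ihy ihz => rw [mul_add]; exact Submodule.add_mem _ ihy ihz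
    | smul c y _ ih => rw [mul_smul_comm]; exact Submodule.smul_mem _ c ih
  | zero => rw [zero_mul]; exact Submodule.zero_mem _
  | add y z _ _ ihy ihz => rw [add_mul]; exact Submodule.add_mem _ ihy ihz
  | smul c y _ ih => rw [smul_mul_assoc]; exact Submodule.smul_mem _ c ih

theorem star_mem_span_of_forall {s r : Set B} (h : ∀ x ∈ s, star x ∈ r) {x : B}
    (hx : x ∈ Submodule.span ℂ s) : star x ∈ Submodule.span ℂ r := by
  induction hx using Submodule.span_induction with
  | mem x hxs => exact Submodule.subset_span (h x hxs)
  | zero => rw [star_zero]; exact Submodule.zero_mem _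
  | add y z _ _ ihy ihz => rw [star_add]; exact Submodule.add_mem _ ihy ihz
  | smul c y _ ih => rw [star_smul]; exact Submodule.smul_mem _ _ ih

theorem mul_mem_homogeneous {j k : ℤ} {x y : B} (hx : x ∈ S.homogeneous j)
    (hy : y ∈ S.homogeneous k) : x * y ∈ S.homogeneous (j + k) :=
  mul_mem_span_of_forall (by
    rintro x ⟨a, b, hx, hab⟩ y ⟨c, d, hy, hcd⟩
    exact Submodule.subset_span ⟨_, _, hx.mul hy, by omega⟩) hx hy

omit [T2Space E0] [LocallyCompactSpace E0] in
theorem star_mem_homogeneous {k : ℤ} {x : B} (hx : x ∈ S.homogeneous k) :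
    star x ∈ S.homogeneous (-k) :=
  star_mem_span_of_forall (by
    rintro x ⟨a, b, hx, hab⟩
    exact ⟨_, _, hx.adjoint, by omega⟩) hx

theorem mul_mem_core {n : ℕ} {x y : B} (hx : x ∈ S.core n) (hy : y ∈ S.core n) :
    x * y ∈ S.core n :=
  mul_mem_span_of_forall (by
    rintro x ⟨a, ha, hx⟩ y ⟨c, hc, hy⟩
    have h := hx.mul hy
    have h1 : c + (a - c) = a + (c - a) := by omega
    rw [h1] at h
    exact Submodule.subset_span ⟨_, by omega, h⟩) hx hy

omit [T2Space E0] [LocallyCompactSpace E0] in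
theorem star_mem_core {n : ℕ} {x : B} (hx : x ∈ S.core n) : star x ∈ S.core n :=
  star_mem_span_of_forall (by
    rintro x ⟨a, ha, hx⟩
    exact ⟨a, ha, hx.adjoint⟩) hx

/-- Conjugation by homogeneous elements preserves the elements without a part of degree zero. -/
theorem mul_mul_mem_offDegreeZero {k : ℤ} {x u y : B} (hx : x ∈ S.homogeneous k)
    (hu : u ∈ S.offDegreeZero) (hy : y ∈ S.homogeneous (-k)) : x * u * y ∈ S.offDegreeZero := by
  refine mul_mem_span_of_forall (s := {z | ∃ a b : ℕ, S.IsMonomial a b z ∧ (a : ℤ) - b ≠ k}) ?_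
    (mul_mem_span_of_forall ?_ hx hu) hy
  · rintro x ⟨a, b, hx, hab⟩ y ⟨c, d, hy, hcd⟩
    exact Submodule.subset_span ⟨_, _, hx.mul hy, by omega⟩
  · rintro x ⟨a, b, hx, hab⟩ y ⟨c, d, hy, hcd⟩
    exact Submodule.subset_span ⟨_, _, hx.mul hy, by omega⟩

omit [T2Space E0] [LocallyCompactSpace E0] in
theorem exists_mem_core {x : B} (hx : x ∈ S.homogeneous 0) : ∃ n, x ∈ S.core n := by
  induction hx using Submodule.span_induction with
  | mem x h =>
    obtain ⟨a, b, h, hab⟩ := h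
    obtain rfl : a = b := by omega
    exact ⟨a, Submodule.subset_span ⟨a, le_rfl, h⟩⟩
  | zero => exact ⟨0, Submodule.zero_mem _⟩
  | add y z _ _ ihy ihz =>
    obtain ⟨m, hm⟩ := ihy
    obtain ⟨n, hn⟩ := ihz
    exact ⟨max m n, Submodule.add_mem _ (core_mono (le_max_left _ _) hm)
      (core_mono (le_max_right _ _) hn)⟩
  | smul c y _ ih =>
    obtain ⟨n, hn⟩ := ih
    exact ⟨n, Submodule.smul_mem _ c hn⟩

end ToeplitzPair

end Monomials

/-! ### Compression along edges -/

section Compression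

variable {E0 E1 : Type u} [TopologicalSpace E0] [TopologicalSpace E1] [T2Space E1]
  {E : TopologicalGraph E0 E1} {B : Type v} [NonUnitalCStarAlgebra B]

namespace ToeplitzPair

variable (S : E.ToeplitzPair B)

/-- The compression `w ↦ T¹(ζ)⋆ w T¹(ζ)`. -/
def compress (ζ : E.Cd) : B →ₗ[ℂ] B where
  toFun w := star (S.T1 ζ) * w * S.T1 ζ
  map_add' x y := by rw [mul_add, add_mul]
  map_smul' c x := by rw [mul_smul_comm, smul_mul_assoc, RingHom.id_apply]

theorem compress_apply (ζ : E.Cd) (w : B) : S.compress ζ w = star (S.T1 ζ) * w * S.T1 ζ := rfl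

theorem compress_T0 (ζ : E.Cd) (f : C₀(E0, ℂ)) :
    S.compress ζ (S.T0 f) = S.T0 (Cd.ip ζ (E.leftAction f ζ)) := by
  rw [compress_apply, mul_assoc, S.T0_mul_T1, S.star_T1_mul_T1]

theorem star_compress (ζ : E.Cd) (w : B) : star (S.compress ζ w) = S.compress ζ (star w) := by
  rw [compress_apply, compress_apply, star_mul, star_mul, star_star, mul_assoc]

variable {S}

theorem mul_eq_zero_of_disjoint {ξ ζ : E.Cd} (h : ∀ e, ξ e = 0 ∨ ζ e = 0) :
    star (S.T1 ζ) * S.T1 ξ = 0 := by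
  rw [S.star_T1_mul_T1]
  have : Cd.ip ζ ξ = 0 := by
    ext v
    rw [Cd.ip_apply]
    refine (tsum_congr fun e => ?_).trans tsum_zero
    rcases h e with h | h <;> simp [h]
  rw [this, map_zero]

/-- `S.IsAvoiding ζ i j x`: the element `x` is a product `T¹(ξ₁) ⋯ T¹(ξᵢ) T¹(η₁) ⋯ T¹(ηⱼ) T⁰(f)`
with compactly supported factors, where each of the last `j` factors `ηₖ` satisfies `ηₖ ζ = 0`. -/
inductive IsAvoiding (S : E.ToeplitzPair B) (ζ : E.Cd) : ℕ → ℕ → B → Prop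
  | T0 (f : C₀(E0, ℂ)) : IsAvoiding S ζ 0 0 (S.T0 f)
  | avoid {j : ℕ} {x : B} (η : E.Cd) (hη : HasCompactSupport η) (hζ : ∀ e, η e = 0 ∨ ζ e = 0)
      (hx : IsAvoiding S ζ 0 j x) : IsAvoiding S ζ 0 (j + 1) (S.T1 η * x)
  | any {i j : ℕ} {x : B} (ξ : E.Cd) (hξ : HasCompactSupport ξ)
      (hx : IsAvoiding S ζ i j x) : IsAvoiding S ζ (i + 1) j (S.T1 ξ * x)

theorem leftAction_disjoint {η ζ : E.Cd} (h : ∀ e, η e = 0 ∨ ζ e = 0) (f : C₀(E0, ℂ)) (e : E1) :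
    E.leftAction f η e = 0 ∨ ζ e = 0 :=
  (h e).imp_left fun h => by rw [leftAction_apply, h, mul_zero]

theorem IsAvoiding.T0_mul {ζ : E.Cd} {i j : ℕ} {x : B} (h : IsAvoiding S ζ i j x)
    (f : C₀(E0, ℂ)) : IsAvoiding S ζ i j (S.T0 f * x) := by
  cases h with
  | T0 g => rw [← map_mul]; exact .T0 _
  | avoid η hη hζ hx =>
    rw [← mul_assoc, S.T0_mul_T1]
    exact .avoid _ (Cd.hasCompactSupport_leftAction hη f) (leftAction_disjoint hζ f) hx
  | any ξ hξ hx =>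
    rw [← mul_assoc, S.T0_mul_T1]
    exact .any _ (Cd.hasCompactSupport_leftAction hξ f) hx

theorem IsAvoiding.star_T1_mul {ζ : E.Cd} {i j : ℕ} {x : B} (h : IsAvoiding S ζ (i + 1) j x)
    (ξ : E.Cd) : IsAvoiding S ζ i j (star (S.T1 ξ) * x) := by
  cases h with
  | any η hη hx =>
    rw [← mul_assoc, S.star_T1_mul_T1]
    exact hx.T0_mul _

theorem IsAvoiding.star_T1_mul_zero {ζ : E.Cd} {j : ℕ} {x : B} (h : IsAvoiding S ζ 0 (j + 1) x)
    (ξ : E.Cd) : IsAvoiding S ζ 0 j (star (S.T1 ξ) * x) := by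
  cases h with
  | avoid η hη hζ hx =>
    rw [← mul_assoc, S.star_T1_mul_T1]
    exact hx.T0_mul _

theorem IsAvoiding.compress_eq_zero {ζ : E.Cd} {j : ℕ} {x : B} (h : IsAvoiding S ζ 0 (j + 1) x) :
    S.compress ζ x = 0 := by
  cases h with
  | avoid η hη hζ hx =>
    rw [compress_apply, ← mul_assoc, mul_eq_zero_of_disjoint hζ, zero_mul, zero_mul]

theorem IsMonomial.isAvoiding (ζ : E.Cd) {a : ℕ} {x : B} (h : S.IsMonomial a 0 x) :
    IsAvoiding S ζ a 0 x := by
  induction a generalizing x with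
  | zero =>
    obtain ⟨f, rfl⟩ := h.exists_T0
    exact .T0 f
  | succ a ih =>
    obtain ⟨ξ, y, hξ, hy, rfl⟩ := h.exists_left
    exact .any ξ hξ (ih hy)

variable (S) in
/-- The products that are annihilated by compressing them successively by `k` functions whose
supports are disjoint from that of `ζ`, and finally by `ζ` itself. -/
def escaping (ζ : E.Cd) (k : ℕ) : Set B :=
  {x | (∃ a b, S.IsMonomial a b x ∧ a ≠ b ∧ a ≤ k ∧ b ≤ k) ∨
    ∃ i j, i ≤ k ∧ 0 < i + j ∧ (IsAvoiding S ζ i j x ∨ IsAvoiding S ζ i j (star x))}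

theorem compress_eq_zero_of_mem_escaping {ζ : E.Cd} {x : B} (hx : x ∈ S.escaping ζ 0) :
    S.compress ζ x = 0 := by
  rcases hx with ⟨a, b, -, hab, ha, hb⟩ | ⟨i, j, hi, hij, hx⟩
  · omega
  · obtain rfl : i = 0 := by omega
    obtain ⟨j, rfl⟩ := Nat.exists_eq_succ_of_ne_zero (n := j) (by omega)
    rcases hx with hx | hx
    · exact hx.compress_eq_zero
    · have := hx.compress_eq_zero
      rwa [← star_compress, star_eq_zero] at this

variable (S) in
/-- The span of the monomials other than the `T⁰(f)`. -/
def nonconstant : Submodule ℂ B :=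
  Submodule.span ℂ {x | ∃ a b, S.IsMonomial a b x ∧ (a ≠ 0 ∨ b ≠ 0)}

theorem offDegreeZero_le_nonconstant : S.offDegreeZero ≤ S.nonconstant :=
  Submodule.span_mono fun _ ⟨a, b, hx, hab⟩ => ⟨a, b, hx, by omega⟩

/-- A function supported on the sources has `h ∘ r = 0`, so that `T⁰(h) T¹(ξ) = 0`. -/
theorem T0_mul_mul_T0_eq_zero {h : C₀(E0, ℂ)} (h0 : ∀ v, v ∉ E.sources → h v = 0) {z : B}
    (hz : z ∈ S.nonconstant) : S.T0 (star h) * z * S.T0 h = 0 := by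
  have hT1 : ∀ ξ, S.T0 (star h) * S.T1 ξ = 0 := fun ξ => by
    have h1 : E.leftAction (star h) ξ = 0 := Cd.ext fun e => by
      rw [leftAction_apply, ZeroAtInftyContinuousMap.star_apply,
        h0 _ fun hs => hs (subset_closure ⟨e, rfl⟩), star_zero, zero_mul, Cd.zero_apply]
    rw [S.T0_mul_T1, h1, map_zero]
  induction hz using Submodule.span_induction with
  | mem x hx =>
    obtain ⟨a, b, hx, hab⟩ := hx
    rcases a with _ | a
    · obtain ⟨b, rfl⟩ := Nat.exists_eq_succ_of_ne_zero (n := b) (by omega)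
      obtain ⟨ξ, y, -, -, rfl⟩ := hx.exists_right
      have h2 : star (S.T1 ξ) * S.T0 h = 0 := by
        rw [S.star_T1_mul_T0, ← S.T0_mul_T1, hT1, star_zero]
      rw [mul_assoc, mul_assoc y, h2, mul_zero, mul_zero]
    · obtain ⟨ξ, y, -, -, rfl⟩ := hx.exists_left
      rw [← mul_assoc, hT1, zero_mul, zero_mul]
  | zero => rw [mul_zero, zero_mul]
  | add x y _ _ hx hy => rw [mul_add, add_mul, hx, hy, add_zero]
  | smul c x _ hx => rw [mul_smul_comm, smul_mul_assoc, hx, smul_zero]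

/-- The supports of the outermost factors of the monomials in `z` make up such a compact set. -/
theorem exists_isCompact_forall_compress_eq_zero {z : B} (hz : z ∈ S.nonconstant) :
    ∃ K : Set E1, IsCompact K ∧ ∀ ζ : E.Cd, (∀ e ∈ K, ζ e = 0) → S.compress ζ z = 0 := by
  induction hz using Submodule.span_induction with
  | mem x hx =>
    obtain ⟨a, b, hx, hab⟩ := hx
    rcases a with _ | a
    · obtain ⟨b, rfl⟩ := Nat.exists_eq_succ_of_ne_zero (n := b) (by omega)
      obtain ⟨ξ, y, hξ, -, rfl⟩ := hx.exists_right
      refine ⟨tsupport ξ, hξ, fun ζ hζ => ?_⟩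
      rw [compress_apply, mul_assoc, mul_assoc y, mul_eq_zero_of_disjoint fun e => ?_,
        mul_zero, mul_zero]
      exact or_iff_not_imp_right.2 fun h => hζ e (subset_tsupport ξ h)
    · obtain ⟨ξ, y, hξ, -, rfl⟩ := hx.exists_left
      refine ⟨tsupport ξ, hξ, fun ζ hζ => ?_⟩
      rw [compress_apply, ← mul_assoc, mul_eq_zero_of_disjoint fun e => ?_, zero_mul, zero_mul]
      exact or_iff_not_imp_left.2 fun h => hζ e (subset_tsupport ξ h)
  | zero => exact ⟨∅, isCompact_empty, fun ζ _ => map_zero _⟩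
  | add x y _ _ hx hy =>
    obtain ⟨K, hK, h⟩ := hx
    obtain ⟨K', hK', h'⟩ := hy
    refine ⟨K ∪ K', hK.union hK', fun ζ hζ => ?_⟩
    rw [map_add, h ζ fun e he => hζ e (Or.inl he), h' ζ fun e he => hζ e (Or.inr he), add_zero]
  | smul c x _ hx =>
    obtain ⟨K, hK, h⟩ := hx
    exact ⟨K, hK, fun ζ hζ => by rw [map_smul, h ζ hζ, smul_zero]⟩

theorem exists_mem_span_escaping {u : B} (hu : u ∈ S.offDegreeZero) :
    ∃ N, ∀ k ≥ N, ∀ ζ, u ∈ Submodule.span ℂ (S.escaping ζ k) := by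
  induction hu using Submodule.span_induction with
  | mem x hx =>
    obtain ⟨a, b, hx, hab⟩ := hx
    exact ⟨max a b, fun k hk ζ => Submodule.subset_span
      (Or.inl ⟨a, b, hx, hab, (le_max_left _ _).trans hk, (le_max_right _ _).trans hk⟩)⟩
  | zero => exact ⟨0, fun k _ ζ => Submodule.zero_mem _⟩
  | add x y _ _ hx hy =>
    obtain ⟨M, hM⟩ := hx
    obtain ⟨N, hN⟩ := hy
    exact ⟨max M N, fun k hk ζ => Submodule.add_mem _ (hM k ((le_max_left _ _).trans hk) ζ)
      (hN k ((le_max_right _ _).trans hk) ζ)⟩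
  | smul c x _ hx =>
    obtain ⟨N, hN⟩ := hx
    exact ⟨N, fun k hk ζ => Submodule.smul_mem _ c (hN k hk ζ)⟩

variable [T2Space E0] [LocallyCompactSpace E0]

theorem IsAvoiding.mul_T1 {ζ : E.Cd} {i j : ℕ} {x : B} (h : IsAvoiding S ζ i j x) {η : E.Cd}
    (hη : HasCompactSupport η) (hζ : ∀ e, η e = 0 ∨ ζ e = 0) :
    IsAvoiding S ζ i (j + 1) (x * S.T1 η) := by
  induction h with
  | T0 f =>
    rw [S.T0_mul_T1]
    obtain ⟨h, hh⟩ := Cd.exists_rightMul_eq_self (Cd.hasCompactSupport_leftAction hη f)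
    rw [← hh, ← S.T1_mul_T0]
    exact .avoid _ (Cd.hasCompactSupport_leftAction hη f) (leftAction_disjoint hζ f) (.T0 h)
  | avoid ξ hξ hξζ _ ih => rw [mul_assoc]; exact .avoid ξ hξ hξζ ih
  | any ξ hξ _ ih => rw [mul_assoc]; exact .any ξ hξ ih

/-- Compressing by a function disjoint from `ζ` replaces the leading factor by one at the end that
is disjoint from `ζ`. -/
theorem IsAvoiding.compress {ζ : E.Cd} {k i j : ℕ} {x : B} (h : IsAvoiding S ζ i j x)
    (hi : i ≤ k + 1) (hij : 0 < i + j) {η : E.Cd} (hη : HasCompactSupport η)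
    (hζ : ∀ e, η e = 0 ∨ ζ e = 0) :
    ∃ i' j', i' ≤ k ∧ 0 < i' + j' ∧ IsAvoiding S ζ i' j' (S.compress η x) := by
  rw [compress_apply]
  rcases i with _ | i
  · obtain ⟨j, rfl⟩ := Nat.exists_eq_succ_of_ne_zero (n := j) (by omega)
    exact ⟨0, j + 1, by omega, by omega, (h.star_T1_mul_zero η).mul_T1 hη hζ⟩
  · exact ⟨i, j + 1, by omega, by omega, (h.star_T1_mul η).mul_T1 hη hζ⟩

theorem compress_mem_escaping {ζ η : E.Cd} {k : ℕ} {x : B} (hη : HasCompactSupport η)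
    (hζ : ∀ e, η e = 0 ∨ ζ e = 0) (hx : x ∈ S.escaping ζ (k + 1)) :
    S.compress η x ∈ S.escaping ζ k := by
  have havoid : ∀ i j y, i ≤ k + 1 → 0 < i + j → IsAvoiding S ζ i j y →
      S.compress η y ∈ S.escaping ζ k ∧ S.compress η (star y) ∈ S.escaping ζ k := by
    intro i j y hi hij hy
    obtain ⟨i', j', h1, h2, h3⟩ := hy.compress hi hij hη hζ
    refine ⟨Or.inr ⟨i', j', h1, h2, Or.inl h3⟩, Or.inr ⟨i', j', h1, h2, Or.inr ?_⟩⟩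
    rwa [star_compress, star_star]
  rcases hx with ⟨a, b, hx, hab, ha, hb⟩ | ⟨i, j, hi, hij, hx | hx⟩
  · rcases a with _ | a
    · have := (havoid b 0 (star x) hb (by omega) (hx.adjoint.isAvoiding ζ)).2
      rwa [star_star] at this
    rcases b with _ | b
    · exact (havoid (a + 1) 0 x ha (by omega) (hx.isAvoiding ζ)).1
    · exact Or.inl ⟨a, b, (hx.star_T1_mul η).mul_T1 η, by omega, by omega, by omega⟩
  · exact (havoid i j x hi hij hx).1
  · have := (havoid i j _ hi hij hx).2
    rwa [star_star] at this

theorem compress_mem_offDegreeZero {ζ : E.Cd} (hζ : HasCompactSupport ζ) {u : B}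
    (hu : u ∈ S.offDegreeZero) : S.compress ζ u ∈ S.offDegreeZero := by
  have h := (isMonomial_T1 (S := S) hζ)
  exact mul_mul_mem_offDegreeZero (k := -1) (Submodule.subset_span ⟨_, _, h.adjoint, by simp⟩) hu
    (Submodule.subset_span ⟨_, _, h, by simp⟩)

end ToeplitzPair

end Compression

/-! ### Lower bounds for the image of an element of `C⋆(S)` -/

section Estimates

variable {E0 E1 : Type u} [TopologicalSpace E0] [TopologicalSpace E1] [T2Space E0]
  [LocallyCompactSpace E0] [T2Space E1] {E : TopologicalGraph E0 E1}
  {A B : Type*} [NonUnitalCStarAlgebra A] [NonUnitalCStarAlgebra B]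
  {S : E.ToeplitzPair B} {φ : B →⋆ₙₐ[ℂ] A}

namespace ToeplitzPair

omit [T2Space E0] [LocallyCompactSpace E0] in
theorem norm_le_norm_map_T0 (hφ : Function.Injective fun f => φ (S.T0 f)) (f : C₀(E0, ℂ)) :
    ‖f‖ ≤ ‖φ (S.T0 f)‖ :=
  (NonUnitalStarAlgHom.norm_map (φ.comp S.T0) hφ f).ge

omit [T2Space E0] [LocallyCompactSpace E0] in
theorem norm_map_compress_le {ζ : E.Cd} (hζ : ‖ζ‖ ≤ 1) (w : B) :
    ‖φ (S.compress ζ w)‖ ≤ ‖φ w‖ := by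
  have h1 : ‖φ (S.T1 ζ)‖ ≤ 1 :=
    (NonUnitalStarAlgHom.norm_apply_le φ _).trans ((S.norm_T1_le ζ).trans hζ)
  rw [compress_apply, map_mul, map_mul, map_star]
  calc _ ≤ ‖star (φ (S.T1 ζ))‖ * ‖φ w‖ * ‖φ (S.T1 ζ)‖ :=
        (norm_mul_le _ _).trans (mul_le_mul_of_nonneg_right (norm_mul_le _ _) (norm_nonneg _))
    _ ≤ 1 * ‖φ w‖ * 1 := by
        rw [norm_star]
        gcongr
    _ = ‖φ w‖ := by ring

/-- At a singular vertex `v` the value of `f` is bounded by the norm of `T⁰(f) + z` whenever `z` is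
a combination of monomials other than the `T⁰(g)`. If `v` is a limit of sources, all these
monomials are cut down to zero by a function supported on the sources; otherwise there are edges
arriving arbitrarily near `v` outside any given compact set, and compressing by a bump function at
such an edge annihilates `z`. -/
theorem norm_apply_le_of_notMem_regularVertices [LocallyCompactSpace E1]
    (hφ : Function.Injective fun f => φ (S.T0 f)) {z : B}
    (hz : z ∈ S.nonconstant)
    (f : C₀(E0, ℂ)) {v : E0} (hv : v ∉ E.regularVertices) : ‖f v‖ ≤ ‖φ (S.T0 f + z)‖ := by
  by_contra hlt
  have hlt := not_le.1 hlt
  have hO : IsOpen {w | ‖φ (S.T0 f + z)‖ < ‖f w‖} :=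
    isOpen_lt continuous_const (map_continuous f).norm
  set O := {w | ‖φ (S.T0 f + z)‖ < ‖f w‖}
  by_cases hsce : v ∈ closure E.sources
  · obtain ⟨w, hwO, hws⟩ := mem_closure_iff.1 hsce O hO hlt
    obtain ⟨h, h1, h0, hn⟩ := exists_zeroAtInfty_eq_one (isCompact_singleton (x := w))
      (O := E.sources) isClosed_closure.isOpen_compl (Set.singleton_subset_iff.2 hws)
    have hkill := T0_mul_mul_T0_eq_zero h0 hz
    have heq : S.T0 (star h) * (S.T0 f + z) * S.T0 h = S.T0 (star h * f * h) := by
      rw [mul_add, add_mul, hkill, add_zero, map_mul, map_mul]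
    have hle : ‖φ (S.T0 (star h * f * h))‖ ≤ ‖φ (S.T0 f + z)‖ := by
      have hn1 : ‖φ (S.T0 h)‖ ≤ 1 :=
        (NonUnitalStarAlgHom.norm_apply_le φ _).trans ((S.norm_T0_le h).trans hn)
      rw [← heq, map_mul, map_mul, ← S.star_T0, map_star]
      calc _ ≤ ‖star (φ (S.T0 h))‖ * ‖φ (S.T0 f + z)‖ * ‖φ (S.T0 h)‖ :=
            (norm_mul_le _ _).trans (mul_le_mul_of_nonneg_right (norm_mul_le _ _) (norm_nonneg _))
        _ ≤ 1 * ‖φ (S.T0 f + z)‖ * 1 := by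
            rw [norm_star]
            gcongr
        _ = _ := by ring
    have hval := norm_apply_le_C0 (star h * f * h) w
    rw [ZeroAtInftyContinuousMap.mul_apply, ZeroAtInftyContinuousMap.mul_apply,
      ZeroAtInftyContinuousMap.star_apply, h1 w rfl, star_one, one_mul, mul_one] at hval
    exact absurd (hval.trans ((norm_le_norm_map_T0 hφ _).trans hle)) (not_le.2 hwO)
  · have hfin : v ∉ E.finiteVertices := fun h => hv ⟨h, hsce⟩
    obtain ⟨K, hK, hKz⟩ := exists_isCompact_forall_compress_eq_zero hz
    obtain ⟨V, hVv, hVO, hVc⟩ := local_compact_nhds (hO.mem_nhds hlt)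
    obtain ⟨e, heV, heK⟩ : ∃ e ∈ E.r ⁻¹' V, e ∉ K := by
      by_contra! h
      exact hfin ⟨V, hVv, hK.of_isClosed_subset (hVc.isClosed.preimage E.continuous_r) h⟩
    obtain ⟨ζ, -, hζK, hζ1, hζ⟩ := Cd.exists_bump (E := E) hK.isClosed.isOpen_compl heK
    have h1 : S.compress ζ (S.T0 f + z) = S.T0 (Cd.ip ζ (E.leftAction f ζ)) := by
      rw [map_add, compress_T0, hKz ζ fun e he => hζK e fun h => h he, add_zero]
    have h2 := norm_map_compress_le (φ := φ) (S := S) hζ1 (S.T0 f + z)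
    rw [h1] at h2
    have h3 := norm_apply_le_C0 (Cd.ip ζ (E.leftAction f ζ)) (E.d e)
    rw [hζ] at h3
    exact absurd (h3.trans ((norm_le_norm_map_T0 hφ _).trans h2)) (not_le.2 (hVO heV))

/-- Compression along a walk transports the value of `f` from its range to its domain. -/
theorem exists_compress_walk [LocallyCompactSpace E1] {x y : E0} {l : List E1}
    (h : E.Walk x l y) (f : C₀(E0, ℂ)) {u : B} (hu : u ∈ S.offDegreeZero) :
    ∃ g : C₀(E0, ℂ), ∃ u' ∈ S.offDegreeZero, g y = f x ∧
      ‖φ (S.T0 g + u')‖ ≤ ‖φ (S.T0 f + u)‖ := by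
  induction l generalizing x f u with
  | nil => exact ⟨f, u, hu, by rw [show x = y from h], le_rfl⟩
  | cons e l ih =>
    obtain ⟨ζ, hζc, -, hζ1, hζ⟩ := Cd.exists_bump (E := E) isOpen_univ (Set.mem_univ e)
    obtain ⟨g, u', hu', hg, hle⟩ := ih h.2 (Cd.ip ζ (E.leftAction f ζ))
      (compress_mem_offDegreeZero hζc hu)
    refine ⟨g, u', hu', by rw [hg, hζ, h.1], hle.trans ?_⟩
    rw [← compress_T0, ← map_add]
    exact norm_map_compress_le hζ1 _

/-- Compression along a walk whose last edge `e` occurs only once and which is longer than all the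
monomials in `u` annihilates `u`, so that it bounds the values of `f`. -/
theorem norm_apply_le_of_walk [LocallyCompactSpace E1]
    (hφ : Function.Injective fun f => φ (S.T0 f)) {e : E1} {O : Set E1} (hO : IsOpen O) {ζ : E.Cd}
    (hζO : ∀ e' ∈ O, ζ e' = 0) (hζ1 : ‖ζ‖ ≤ 1)
    (hζ : ∀ f : C₀(E0, ℂ), Cd.ip ζ (E.leftAction f ζ) (E.d e) = f (E.r e)) {x y : E0}
    {l : List E1} (h : E.Walk x (l ++ [e]) y) (hl : ∀ a ∈ l, a ∈ O) (f : C₀(E0, ℂ)) {u : B}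
    (hu : u ∈ Submodule.span ℂ (S.escaping ζ l.length)) : ‖f x‖ ≤ ‖φ (S.T0 f + u)‖ := by
  induction l generalizing x f u with
  | nil =>
    have h1 : S.compress ζ u = 0 := by
      refine (Submodule.span_le (p := LinearMap.ker (S.compress ζ))).2 (fun w hw => ?_) hu
      exact compress_eq_zero_of_mem_escaping hw
    have h2 := norm_map_compress_le (φ := φ) (S := S) hζ1 (S.T0 f + u)
    rw [map_add, compress_T0, h1, add_zero] at h2
    have h3 := norm_apply_le_C0 (Cd.ip ζ (E.leftAction f ζ)) (E.d e)
    rw [hζ, show E.r e = x from h.1] at h3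
    exact h3.trans ((norm_le_norm_map_T0 hφ _).trans h2)
  | cons a l ih =>
    obtain ⟨η, hηc, hηO, hη1, hη⟩ := Cd.exists_bump (E := E) hO (hl a (by simp))
    have hdisj : ∀ e, η e = 0 ∨ ζ e = 0 := fun e' => by
      by_cases he : e' ∈ O
      · exact Or.inr (hζO e' he)
      · exact Or.inl (hηO e' he)
    have hu' : S.compress η u ∈ Submodule.span ℂ (S.escaping ζ l.length) := by
      refine (Submodule.span_le (p := (Submodule.span ℂ (S.escaping ζ l.length)).comap
        (S.compress η))).2 (fun w hw => ?_) hu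
      exact Submodule.subset_span (compress_mem_escaping hηc hdisj hw)
    have h1 := ih h.2 (fun b hb => hl b (List.mem_cons_of_mem _ hb))
      (Cd.ip η (E.leftAction f η)) hu'
    rw [hη, show E.r a = x from h.1, ← compress_T0, ← map_add] at h1
    exact h1.trans (norm_map_compress_le hη1 _)

/-- For a topologically free graph the part `T⁰(f)` of `T⁰(f) + u` is bounded by the whole. -/
theorem norm_le_norm_map_T0_add [LocallyCompactSpace E1] (hE : E.TopologicallyFree)
    (hφ : Function.Injective fun f => φ (S.T0 f)) (f : C₀(E0, ℂ)) {u : B}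
    (hu : u ∈ S.offDegreeZero) : ‖f‖ ≤ ‖φ (S.T0 f + u)‖ := by
  refine norm_le_C0 (norm_nonneg _) fun v => ?_
  by_contra hlt
  have hlt := not_le.1 hlt
  obtain ⟨N, hN⟩ := exists_mem_span_escaping hu
  have hV : IsOpen {w | ‖φ (S.T0 f + u)‖ < ‖f w‖} :=
    isOpen_lt continuous_const (map_continuous f).norm
  rcases hE.exists_walk hV ⟨v, hlt⟩ N with ⟨x, hx, l, y, hw, hy⟩ | ⟨x, hx, l, e, y, hw, hl, hel⟩
  · obtain ⟨g, u', hu', hg, hle⟩ := exists_compress_walk (φ := φ) hw f hu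
    have h1 := norm_apply_le_of_notMem_regularVertices hφ (offDegreeZero_le_nonconstant hu') g hy
    rw [hg] at h1
    exact absurd (h1.trans hle) (not_le.2 hx)
  · obtain ⟨O, O', hO, hO', hlO, heO', hdisj⟩ :=
      SeparatedNhds.of_isCompact_isCompact (l.finite_toSet.isCompact)
        (isCompact_singleton (x := e)) (Set.disjoint_singleton_right.2 hel)
    obtain ⟨ζ, -, hζO, hζ1, hζ⟩ := Cd.exists_bump (E := E) hO' (heO' rfl)
    refine absurd (norm_apply_le_of_walk hφ hO (fun e' he' => hζO e' fun h =>
      Set.disjoint_left.1 hdisj he' h) hζ1 hζ hw hlO f (hN _ hl ζ)) (not_le.2 hx)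

end ToeplitzPair

end Estimates

/-! ### The core -/

section Core

variable {E0 E1 : Type u} [TopologicalSpace E0] [TopologicalSpace E1] [T2Space E1]
  {E : TopologicalGraph E0 E1} {B : Type v} [NonUnitalCStarAlgebra B]

namespace ToeplitzPair

variable (S : E.ToeplitzPair B)

/-- The span of the products of some `T¹(ξ)` with an element of `S.core n`, a module over
`S.core n` on which `S.core (n + 1)` acts from the left. -/
def coreModule (n : ℕ) : Submodule ℂ B :=
  Submodule.span ℂ {x | ∃ ξ : E.Cd, HasCompactSupport ξ ∧ ∃ y ∈ S.core n, x = S.T1 ξ * y}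

/-- The right ideal of `B` generated by `S.coreModule n`. -/
def coreIdeal (n : ℕ) : Submodule ℂ B :=
  Submodule.span ℂ {w | ∃ ζ ∈ S.coreModule n, ∃ b : B, w = ζ * b}

variable {S}

theorem T0_mem_core (f : C₀(E0, ℂ)) (n : ℕ) : S.T0 f ∈ S.core n :=
  Submodule.subset_span ⟨0, Nat.zero_le n, .T0 f⟩

theorem exists_T0_of_mem_core_zero {x : B} (hx : x ∈ S.core 0) : ∃ f, x = S.T0 f := by
  induction hx using Submodule.span_induction with
  | mem x h =>
    obtain ⟨a, ha, hx⟩ := h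
    obtain rfl : a = 0 := by omega
    exact hx.exists_T0
  | zero => exact ⟨0, (map_zero _).symm⟩
  | add x y _ _ hx hy =>
    obtain ⟨f, rfl⟩ := hx
    obtain ⟨g, rfl⟩ := hy
    exact ⟨f + g, (map_add _ _ _).symm⟩
  | smul c x _ hx =>
    obtain ⟨f, rfl⟩ := hx
    exact ⟨c • f, (map_smul _ _ _).symm⟩

theorem IsMonomial.exists_both {a : ℕ} {x : B} (h : S.IsMonomial (a + 1) (a + 1) x) :
    ∃ (ξ η : E.Cd) (y : B), HasCompactSupport ξ ∧ S.IsMonomial a a y ∧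
      x = S.T1 ξ * y * star (S.T1 η) := by
  obtain ⟨ξ, z, hξ, hz, rfl⟩ := h.exists_left
  obtain ⟨η, y, -, hy, rfl⟩ := hz.exists_right
  exact ⟨ξ, η, y, hξ, hy, (mul_assoc _ _ _).symm⟩

theorem exists_T0_add_of_mem_core {n : ℕ} {x : B} (hx : x ∈ S.core (n + 1)) :
    ∃ f, ∃ y ∈ S.nonconstant, y ∈ S.coreIdeal n ∧ x = S.T0 f + y := by
  induction hx using Submodule.span_induction with
  | mem x h =>
    obtain ⟨a, ha, hx⟩ := h
    rcases a with _ | a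
    · obtain ⟨f, rfl⟩ := hx.exists_T0
      exact ⟨f, 0, Submodule.zero_mem _, Submodule.zero_mem _, (add_zero _).symm⟩
    · refine ⟨0, x, Submodule.subset_span ⟨_, _, hx, by omega⟩, ?_, by rw [map_zero, zero_add]⟩
      obtain ⟨ξ, η, y, hξ, hy, rfl⟩ := hx.exists_both
      exact Submodule.subset_span ⟨_, Submodule.subset_span
        ⟨ξ, hξ, y, Submodule.subset_span ⟨a, by omega, hy⟩, rfl⟩, _, rfl⟩
  | zero =>
    exact ⟨0, 0, Submodule.zero_mem _, Submodule.zero_mem _, by rw [map_zero, zero_add]⟩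
  | add x y _ _ hx hy =>
    obtain ⟨f, z, h1, h2, rfl⟩ := hx
    obtain ⟨g, z', h3, h4, rfl⟩ := hy
    exact ⟨f + g, z + z', Submodule.add_mem _ h1 h3, Submodule.add_mem _ h2 h4, by
      rw [map_add]; abel⟩
  | smul c x _ hx =>
    obtain ⟨f, z, h1, h2, rfl⟩ := hx
    exact ⟨c • f, c • z, Submodule.smul_mem _ c h1, Submodule.smul_mem _ c h2, by
      rw [map_smul, smul_add]⟩

variable [T2Space E0] [LocallyCompactSpace E0]

theorem mul_mem_coreModule {n : ℕ} {x ζ : B} (hx : x ∈ S.core (n + 1))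
    (hζ : ζ ∈ S.coreModule n) : x * ζ ∈ S.coreModule n := by
  refine mul_mem_span_of_forall ?_ hx hζ
  rintro x ⟨a, ha, hx⟩ _ ⟨ξ, hξ, y, hy, rfl⟩
  refine Submodule.subset_span ?_
  rcases a with _ | a
  · obtain ⟨f, rfl⟩ := hx.exists_T0
    exact ⟨_, Cd.hasCompactSupport_leftAction hξ f, y, hy, by rw [← mul_assoc, S.T0_mul_T1]⟩
  · obtain ⟨η, η', z, hη, hz, rfl⟩ := hx.exists_both
    refine ⟨η, hη, z * (S.T0 (Cd.ip η' ξ) * y), mul_mem_core (Submodule.subset_span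
      ⟨a, by omega, hz⟩) (mul_mem_core (T0_mem_core _ n) hy), ?_⟩
    rw [← S.star_T1_mul_T1]
    simp only [mul_assoc]

theorem star_mul_mem_core {n : ℕ} {ζ ζ' : B} (hζ : ζ ∈ S.coreModule n)
    (hζ' : ζ' ∈ S.coreModule n) : star ζ * ζ' ∈ S.core n := by
  have h1 : star ζ ∈ Submodule.span ℂ {x | ∃ ξ : E.Cd, ∃ y ∈ S.core n, x = y * star (S.T1 ξ)} :=
    star_mem_span_of_forall (by
      rintro _ ⟨ξ, -, y, hy, rfl⟩
      exact ⟨ξ, star y, star_mem_core hy, star_mul _ _⟩) hζ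
  refine mul_mem_span_of_forall ?_ h1 hζ'
  rintro _ ⟨ξ, y, hy, rfl⟩ _ ⟨η, -, z, hz, rfl⟩
  rw [mul_assoc, ← mul_assoc (star _), S.star_T1_mul_T1]
  exact mul_mem_core hy (mul_mem_core (T0_mem_core _ n) hz)

theorem coreModule_le_homogeneous (n : ℕ) : S.coreModule n ≤ S.homogeneous 1 := by
  refine Submodule.span_le.2 ?_
  rintro _ ⟨ξ, hξ, y, hy, rfl⟩
  have h1 : S.T1 ξ ∈ S.homogeneous 1 := Submodule.subset_span ⟨1, 0, isMonomial_T1 hξ, by simp⟩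
  have h2 := mul_mem_homogeneous h1 (core_le_homogeneous n hy)
  rwa [add_zero] at h2

theorem T1_mul_mem_closure_coreIdeal [LocallyCompactSpace E1] (n : ℕ) (ξ : E.Cd) (b : B) :
    S.T1 ξ * b ∈ (S.coreIdeal n).topologicalClosure := by
  refine Metric.mem_closure_iff.2 fun ε hε => ?_
  obtain ⟨η, hη, hle⟩ := Cd.exists_hasCompactSupport_norm_sub_le ξ
    (ε := ε / (‖b‖ + 1)) (by positivity)
  obtain ⟨h, hh⟩ := Cd.exists_rightMul_eq_self hη
  refine ⟨S.T1 η * b, Submodule.subset_span ⟨S.T1 η, Submodule.subset_span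
    ⟨η, hη, S.T0 h, T0_mem_core h n, by rw [S.T1_mul_T0, hh]⟩, b, rfl⟩, ?_⟩
  rw [dist_eq_norm, ← sub_mul, ← map_sub]
  calc _ ≤ ‖S.T1 (ξ - η)‖ * ‖b‖ := norm_mul_le _ _
    _ ≤ ε / (‖b‖ + 1) * ‖b‖ := by
        gcongr
        exact (S.norm_T1_le _).trans hle
    _ < ε := by
        rw [div_mul_eq_mul_div, div_lt_iff₀ (by positivity)]
        nlinarith [norm_nonneg b]

end ToeplitzPair

namespace CuntzKriegerPair

open ToeplitzPair

variable [T2Space E0] [LocallyCompactSpace E0] [LocallyCompactSpace E1]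

/-- By the Cuntz-Krieger relation, `T⁰(f)` for `f ∈ C₀(E⁰_rg)` can be absorbed into the part of the
core that starts with some `T¹(ξ)`. -/
theorem T0_mem_closure_coreIdeal (S : E.CuntzKriegerPair B) (n : ℕ) {f : C₀(E0, ℂ)}
    (hf : f ∈ E.regularFunctions) :
    S.T0 f ∈ (S.toToeplitzPair.coreIdeal n).topologicalClosure := by
  rw [S.T0_eq_Phi f hf]
  have hcl : IsClosed ((S.toToeplitzPair.coreIdeal n).topologicalClosure : Set B) :=
    isClosed_closure
  refine ToeplitzPair.denseRange_sumTheta.induction_on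
    (p := fun k => S.Phi k ∈ (S.toToeplitzPair.coreIdeal n).topologicalClosure) _
    (hcl.preimage S.Phi.continuous) fun c => ?_
  induction c using Finsupp.induction_linear with
  | zero => rw [map_zero, map_zero]; exact Submodule.zero_mem _
  | add c c' h h' => rw [map_add, map_add]; exact Submodule.add_mem _ h h'
  | single p a =>
    have h1 : sumTheta E (Finsupp.single p a) =
        a • (⟨theta p.1 p.2, theta_mem_compacts p.1 p.2⟩ : E.compacts) := by
      simp [sumTheta]
    rw [h1, map_smul, S.Phi_theta]
    exact Submodule.smul_mem _ _ (T1_mul_mem_closure_coreIdeal n _ _)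

variable {A : Type*} [NonUnitalCStarAlgebra A] {φ : B →⋆ₙₐ[ℂ] A}

/-- For a topologically free graph the part of degree zero of an element is bounded by its image
under a ⋆-homomorphism that is injective on `T⁰(C₀(E⁰))`. The induction on the level of the core
bounds a self-adjoint `x` on `coreModule n` by the previous level, and its part `T⁰(f)` at the
singular vertices; up to an element of the closed right ideal generated by `coreModule n` there is
nothing else. -/
theorem norm_le_norm_map_add (S : E.CuntzKriegerPair B) (hE : E.TopologicallyFree)
    (hφ : Function.Injective fun f => φ (S.T0 f)) (n : ℕ) {x u : B}
    (hx : x ∈ S.toToeplitzPair.core n) (hu : u ∈ S.toToeplitzPair.offDegreeZero) :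
    ‖x‖ ≤ ‖φ (x + u)‖ := by
  induction n generalizing x u with
  | zero =>
    obtain ⟨f, rfl⟩ := exists_T0_of_mem_core_zero hx
    exact (S.norm_T0_le f).trans (norm_le_norm_map_T0_add hE hφ f hu)
  | succ n ih =>
    have hsa : ∀ {x u : B}, IsSelfAdjoint x → x ∈ S.toToeplitzPair.core (n + 1) →
        u ∈ S.toToeplitzPair.offDegreeZero → ‖x‖ ≤ ‖φ (x + u)‖ := by
      intro x u hxs hx hu
      by_contra hlt
      have hlt := not_le.1 hlt
      set c := ‖φ (x + u)‖ with hc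
      have hc0 : 0 ≤ c := norm_nonneg _
      have hx0 : 0 < ‖x‖ := hc0.trans_lt hlt
      have hcp : c ≤ √(‖x‖ * c) := Real.le_sqrt_of_sq_le (by nlinarith)
      obtain ⟨f, y, hy1, hy2, rfl⟩ := exists_T0_add_of_mem_core hx
      have hsing : ∀ v, v ∉ E.regularVertices → ‖f v‖ ≤ √(‖S.T0 f + y‖ * c) := fun v hv => by
        refine le_trans ?_ hcp
        rw [hc, add_assoc]
        exact norm_apply_le_of_notMem_regularVertices hφ
          (Submodule.add_mem _ hy1 (offDegreeZero_le_nonconstant hu)) f hv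
      obtain ⟨g, h, hfgh, hg, hh⟩ :=
        exists_add_mem_regularFunctions E (Real.sqrt_nonneg (‖S.T0 f + y‖ * c)) hsing
      have hb : ∀ ζ ∈ S.toToeplitzPair.coreModule n,
          ‖(S.T0 f + y) * ζ‖ ≤ √(‖S.T0 f + y‖ * c) * ‖ζ‖ := by
        intro ζ hζ
        set x := S.T0 f + y with hxdef
        have h1 : star ζ * x * (x * ζ) ∈ S.toToeplitzPair.core n := by
          have := star_mul_mem_core (mul_mem_coreModule hx hζ) (mul_mem_coreModule hx hζ)
          rwa [star_mul, hxs.star_eq] at this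
        have h2 : star ζ * x * u * ζ ∈ S.toToeplitzPair.offDegreeZero := by
          have h3 := coreModule_le_homogeneous n hζ
          have h4 := mul_mem_homogeneous (star_mem_homogeneous h3) (core_le_homogeneous _ hx)
          exact mul_mul_mem_offDegreeZero h4 hu (by simpa using h3)
        have h5 := ih h1 h2
        have h6 : star ζ * x * (x * ζ) + star ζ * x * u * ζ = star ζ * x * (x + u) * ζ := by
          rw [mul_add (star ζ * x) x u, add_mul (star ζ * x * x), mul_assoc (star ζ * x) x ζ]
        have hnorm : ‖x * ζ‖ ^ 2 ≤ ‖x‖ * c * ‖ζ‖ ^ 2 := by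
          have h7 := CStarRing.norm_star_mul_self (x := x * ζ)
          rw [star_mul, hxs.star_eq, ← sq] at h7
          rw [← h7]
          refine h5.trans ?_
          rw [h6, map_mul, map_mul]
          calc _ ≤ ‖φ (star ζ * x)‖ * c * ‖φ ζ‖ :=
                (norm_mul_le _ _).trans
                  (mul_le_mul_of_nonneg_right (norm_mul_le _ _) (norm_nonneg _))
            _ ≤ (‖ζ‖ * ‖x‖) * c * ‖ζ‖ := by
                gcongr
                · refine (NonUnitalStarAlgHom.norm_apply_le φ _).trans ((norm_mul_le _ _).trans ?_)
                  rw [norm_star]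
                · exact NonUnitalStarAlgHom.norm_apply_le φ _
            _ = _ := by ring
        refine le_of_sq_le_sq ?_ (by positivity)
        rwa [mul_pow, Real.sq_sqrt (by positivity)]
      have hle := norm_le_of_bounded_on_subspace hxs (y := S.T0 g) (z := S.T0 h + y)
        (by rw [hfgh, map_add, add_assoc]) (Real.sqrt_nonneg _)
        (fun ζ hζ => mul_mem_coreModule hx hζ) hb ((S.norm_T0_le g).trans hg)
        (Submodule.add_mem (S.toToeplitzPair.coreIdeal n).topologicalClosure
          (S.T0_mem_closure_coreIdeal n hh) (Submodule.le_topologicalClosure _ hy2))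
      have h9 : ‖S.T0 f + y‖ ^ 2 ≤ ‖S.T0 f + y‖ * c := (Real.le_sqrt' hx0).1 hle
      nlinarith
    -- the general case follows by multiplying by `star x` from the left
    have h1 := hsa (IsSelfAdjoint.star_mul_self x) (mul_mem_core (star_mem_core hx) hx)
      (u := star x * u) (by
        refine mul_mem_span_of_forall ?_ (star_mem_core hx) hu
        rintro x ⟨a, -, hx⟩ y ⟨c, d, hy, hcd⟩
        exact Submodule.subset_span ⟨_, _, hx.mul hy, by omega⟩)
    rw [CStarRing.norm_star_mul_self, ← mul_add, map_mul] at h1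
    rcases (norm_nonneg x).eq_or_lt with h0 | h0
    · rw [← h0]
      exact norm_nonneg _
    · refine le_of_mul_le_mul_left (h1.trans ((norm_mul_le _ _).trans ?_)) h0
      refine mul_le_mul_of_nonneg_right ?_ (norm_nonneg _)
      exact (NonUnitalStarAlgHom.norm_apply_le φ _).trans (norm_star x).le

end CuntzKriegerPair

end Core

/-! ### The uniqueness theorem -/

section Uniqueness

variable {E0 E1 : Type u} [TopologicalSpace E0] [TopologicalSpace E1] [T2Space E1]
  {E : TopologicalGraph E0 E1} {B : Type v} [NonUnitalCStarAlgebra B]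

namespace ToeplitzPair

variable (S : E.ToeplitzPair B)

/-- The span of the monomials whose degree has absolute value at most `N`. -/
def degreeLE (N : ℕ) : Submodule ℂ B :=
  Submodule.span ℂ {x | ∃ a b : ℕ, S.IsMonomial a b x ∧ |(a : ℤ) - b| ≤ N}

variable {S}

theorem degreeLE_mono {M N : ℕ} (h : M ≤ N) : S.degreeLE M ≤ S.degreeLE N :=
  Submodule.span_mono fun _ ⟨a, b, hx, hab⟩ => ⟨a, b, hx, by omega⟩

theorem star_mem_degreeLE {N : ℕ} {x : B} (hx : x ∈ S.degreeLE N) : star x ∈ S.degreeLE N :=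
  star_mem_span_of_forall (by
    rintro x ⟨a, b, hx, hab⟩
    exact ⟨b, a, hx.adjoint, by rwa [abs_sub_comm]⟩) hx

theorem exists_sum_of_mem_degreeLE {N : ℕ} {x : B} (hx : x ∈ S.degreeLE N) :
    ∃ c : ℤ → B, (∀ k, c k ∈ S.homogeneous k) ∧ x = ∑ k ∈ Finset.Icc (-N : ℤ) N, c k := by
  induction hx using Submodule.span_induction with
  | mem x h =>
    obtain ⟨a, b, hx, hab⟩ := h
    refine ⟨Pi.single ((a : ℤ) - b) x, fun k => ?_, ?_⟩
    · by_cases hk : k = (a : ℤ) - b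
      · subst hk
        rw [Pi.single_eq_same]
        exact Submodule.subset_span ⟨a, b, hx, rfl⟩
      · rw [Pi.single_eq_of_ne hk]
        exact Submodule.zero_mem _
    · rw [Finset.sum_pi_single', if_pos (Finset.mem_Icc.2 (abs_le.1 hab))]
  | zero => exact ⟨0, fun k => Submodule.zero_mem _, by simp⟩
  | add x y _ _ hx hy =>
    obtain ⟨c, hc, rfl⟩ := hx
    obtain ⟨c', hc', rfl⟩ := hy
    exact ⟨c + c', fun k => Submodule.add_mem _ (hc k) (hc' k), by simp [Finset.sum_add_distrib]⟩
  | smul a x _ hx =>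
    obtain ⟨c, hc, rfl⟩ := hx
    exact ⟨a • c, fun k => Submodule.smul_mem _ a (hc k), by simp [Finset.smul_sum]⟩

variable [T2Space E0] [LocallyCompactSpace E0]

theorem mul_mem_degreeLE {M N : ℕ} {x y : B} (hx : x ∈ S.degreeLE M) (hy : y ∈ S.degreeLE N) :
    x * y ∈ S.degreeLE (M + N) :=
  mul_mem_span_of_forall (by
    rintro x ⟨a, b, hx, hab⟩ y ⟨c, d, hy, hcd⟩
    refine Submodule.subset_span ⟨_, _, hx.mul hy, ?_⟩
    rw [abs_le] at hab hcd ⊢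
    omega) hx hy

variable (S) in
/-- The dense ⋆-subalgebra of `C⋆(S)` spanned by the monomials. -/
def monomialAlgebra : NonUnitalStarSubalgebra ℂ B where
  carrier := {x | ∃ N, x ∈ S.degreeLE N}
  zero_mem' := ⟨0, Submodule.zero_mem _⟩
  add_mem' := by
    rintro x y ⟨M, hM⟩ ⟨N, hN⟩
    exact ⟨max M N, Submodule.add_mem _ (degreeLE_mono (le_max_left _ _) hM)
      (degreeLE_mono (le_max_right _ _) hN)⟩
  mul_mem' := by
    rintro x y ⟨M, hM⟩ ⟨N, hN⟩
    exact ⟨_, mul_mem_degreeLE hM hN⟩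
  smul_mem' := by
    rintro c x ⟨N, hN⟩
    exact ⟨N, Submodule.smul_mem _ c hN⟩
  star_mem' := by
    rintro x ⟨N, hN⟩
    exact ⟨N, star_mem_degreeLE hN⟩

theorem algebra_le_closure_monomialAlgebra [LocallyCompactSpace E1] :
    S.algebra ≤ S.monomialAlgebra.topologicalClosure := by
  refine NonUnitalStarSubalgebra.topologicalClosure_minimal _
    (NonUnitalStarAlgebra.adjoin_le ?_) isClosed_closure
  rintro _ (⟨f, rfl⟩ | ⟨ξ, rfl⟩)
  · exact NonUnitalStarSubalgebra.le_topologicalClosure _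
      ⟨0, Submodule.subset_span ⟨0, 0, .T0 f, by simp⟩⟩
  · refine Metric.mem_closure_iff.2 fun ε hε => ?_
    obtain ⟨η, hη, hle⟩ := Cd.exists_hasCompactSupport_norm_sub_le ξ (half_pos hε)
    refine ⟨S.T1 η, ⟨1, Submodule.subset_span ⟨1, 0, isMonomial_T1 hη, by simp⟩⟩, ?_⟩
    rw [dist_eq_norm, ← map_sub]
    exact ((S.norm_T1_le _).trans hle).trans_lt (half_lt_self hε)

end ToeplitzPair

namespace CuntzKriegerPair

open ToeplitzPair

variable [T2Space E0] [LocallyCompactSpace E0] [LocallyCompactSpace E1]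
  {A : Type*} [NonUnitalCStarAlgebra A] {φ : B →⋆ₙₐ[ℂ] A}

/-- Each homogeneous part of an element is bounded by its image. -/
theorem norm_le_norm_map_sum (S : E.CuntzKriegerPair B) (hE : E.TopologicallyFree)
    (hφ : Function.Injective fun f => φ (S.T0 f)) {s : Finset ℤ} {c : ℤ → B}
    (hc : ∀ k, c k ∈ S.toToeplitzPair.homogeneous k) {k : ℤ} (hk : k ∈ s) :
    ‖c k‖ ≤ ‖φ (∑ j ∈ s, c j)‖ := by
  have h0 : star (c k) * c k ∈ S.toToeplitzPair.homogeneous 0 := by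
    simpa using mul_mem_homogeneous (star_mem_homogeneous (hc k)) (hc k)
  obtain ⟨n, hn⟩ := exists_mem_core h0
  have hu : ∑ j ∈ s.erase k, star (c k) * c j ∈ S.toToeplitzPair.offDegreeZero := by
    refine Submodule.sum_mem _ fun j hj => ?_
    refine homogeneous_le_offDegreeZero ?_
      (mul_mem_homogeneous (star_mem_homogeneous (hc k)) (hc j))
    have := Finset.ne_of_mem_erase hj
    omega
  have h1 := S.norm_le_norm_map_add hE hφ n hn hu
  rw [Finset.add_sum_erase s (fun j => star (c k) * c j) hk, ← Finset.mul_sum,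
    CStarRing.norm_star_mul_self, map_mul] at h1
  rcases (norm_nonneg (c k)).eq_or_lt with h2 | h2
  · rw [← h2]
    exact norm_nonneg _
  · refine le_of_mul_le_mul_left (h1.trans ((norm_mul_le _ _).trans ?_)) h2
    refine mul_le_mul_of_nonneg_right ?_ (norm_nonneg _)
    exact (NonUnitalStarAlgHom.norm_apply_le φ _).trans (norm_star (c k)).le

theorem norm_le_mul_norm_map (S : E.CuntzKriegerPair B) (hE : E.TopologicallyFree)
    (hφ : Function.Injective fun f => φ (S.T0 f)) {N : ℕ} {x : B}
    (hx : x ∈ S.toToeplitzPair.degreeLE N) : ‖x‖ ≤ (2 * N + 1) * ‖φ x‖ := by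
  obtain ⟨c, hc, rfl⟩ := exists_sum_of_mem_degreeLE hx
  refine (norm_sum_le_of_le _ fun k hk => S.norm_le_norm_map_sum hE hφ hc hk).trans ?_
  rw [Finset.sum_const, Int.card_Icc, nsmul_eq_mul]
  refine mul_le_mul_of_nonneg_right ?_ (norm_nonneg _)
  have h1 : ((N : ℤ) + 1 - -N).toNat = 2 * N + 1 := by omega
  rw [h1]
  push_cast
  exact le_rfl

/-- A ⋆-homomorphism that is injective on `T⁰(C₀(E⁰))` is isometric on `C⋆(S)`. On the linear
combinations of monomials the estimate holds with a constant that grows linearly with the degree;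
applying it to the powers of `x⋆x` removes the constant. -/
theorem norm_le_norm_map (S : E.CuntzKriegerPair B) (hE : E.TopologicallyFree)
    (hφ : Function.Injective fun f => φ (S.T0 f)) {x : B} (hx : x ∈ S.algebra) :
    ‖x‖ ≤ ‖φ x‖ := by
  have hcont : Continuous φ := AddMonoidHomClass.continuous_of_bound φ 1 fun x => by
    simpa using NonUnitalStarAlgHom.norm_apply_le φ x
  have hcl : IsClosed {x : B | ‖x‖ ≤ ‖φ x‖} := isClosed_le continuous_norm hcont.norm
  refine closure_minimal ?_ hcl (algebra_le_closure_monomialAlgebra hx)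
  rintro x ⟨N, hN⟩
  have hsa : IsSelfAdjoint (star x * x) := .star_mul_self x
  set y := star x * x with hy
  have hy1 : y ∈ S.toToeplitzPair.degreeLE (2 * N) := by
    rw [two_mul]
    exact mul_mem_degreeLE (star_mem_degreeLE hN) hN
  have hpow : ∀ k : ℕ, (y * ·)^[k] y ∈ S.toToeplitzPair.degreeLE ((k + 1) * (2 * N)) ∧
      ‖φ ((y * ·)^[k] y)‖ ≤ ‖φ y‖ ^ (k + 1) := by
    intro k
    induction k with
    | zero => simpa using hy1
    | succ k ih =>
      rw [Function.iterate_succ_apply', map_mul, add_one_mul (k + 1), add_comm _ (2 * N), pow_succ']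
      exact ⟨mul_mem_degreeLE hy1 ih.1,
        (norm_mul_le _ _).trans (mul_le_mul_of_nonneg_left ih.2 (norm_nonneg _))⟩
  have hle : ‖y‖ ≤ ‖φ y‖ := by
    refine norm_le_of_norm_iterate_le (a := 4 * N * ‖φ y‖) (b := (4 * N + 1) * ‖φ y‖) hsa
      (norm_nonneg _) fun k => ?_
    refine (S.norm_le_mul_norm_map hE hφ (hpow k).1).trans ?_
    refine (mul_le_mul_of_nonneg_left (hpow k).2 (by positivity)).trans_eq ?_
    push_cast
    ring
  rw [hy, map_mul, map_star, CStarRing.norm_star_mul_self, CStarRing.norm_star_mul_self] at hle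
  exact le_of_sq_le_sq (by rwa [sq, sq]) (norm_nonneg _)

end CuntzKriegerPair

end Uniqueness

end

end TopologicalGraph

theorem theorem5 {E0 E1 : Type u} [TopologicalSpace E0] [TopologicalSpace E1]
    [LocallyCompactSpace E0] [T2Space E0] [LocallyCompactSpace E1] [T2Space E1]
    (E : TopologicalGraph E0 E1) (hE : E.TopologicallyFree)
    {A : Type u} [NonUnitalCStarAlgebra A] (T : E.CuntzKriegerPair A)
    (hT : Function.Injective T.T0) :
    Function.Bijective (TopologicalGraph.rho T) := by
  let φ := TopologicalGraph.evalHom (⟨A, T⟩ : E.BundledPair)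
  have hle : ∀ x : E.CKAlgebra, ‖x‖ ≤ ‖φ x‖ := fun x =>
    E.universalPair.norm_le_norm_map (φ := φ) hE hT x.2
  have hinj : Function.Injective (TopologicalGraph.rho T) := by
    intro x y hxy
    have h1 := hle (x - y)
    have h2 : φ (x - y : E.CKAlgebra) = 0 := by
      have h3 : φ x = φ y := congrArg Subtype.val hxy
      rw [NonUnitalStarSubalgebra.coe_sub, map_sub, h3, sub_self]
    rw [h2, norm_zero] at h1
    exact sub_eq_zero.1 (norm_le_zero_iff.1 h1)
  refine ⟨hinj, ?_⟩
  have hcl : IsClosed (E.CKAlgebra : Set E.BigProduct) := isClosed_closure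
  have : CompleteSpace E.CKAlgebra := hcl.completeSpace_coe
  have hiso : Isometry fun x : E.CKAlgebra => φ x :=
    AddMonoidHomClass.isometry_of_norm
      (φ.comp (NonUnitalStarSubalgebraClass.subtype E.CKAlgebra)) fun x =>
        le_antisymm (NonUnitalStarAlgHom.norm_apply_le φ _) (hle x)
  have hrange : ((E.CKAlgebra.map φ : NonUnitalStarSubalgebra ℂ A) : Set A) =
      Set.range fun x : E.CKAlgebra => φ x := by
    rw [NonUnitalStarSubalgebra.coe_map]
    exact Set.image_eq_range _ _
  have hgen : T.algebra ≤ E.CKAlgebra.map φ := by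
    refine NonUnitalStarSubalgebra.topologicalClosure_minimal _
      (NonUnitalStarAlgebra.adjoin_le ?_) (hrange ▸ hiso.isClosedEmbedding.isClosed_range)
    rintro _ (⟨f, rfl⟩ | ⟨ξ, rfl⟩)
    · exact ⟨_, E.universalPair.T0_mem f, rfl⟩
    · exact ⟨_, E.universalPair.T1_mem ξ, rfl⟩
  intro y
  obtain ⟨x, hx, hxy⟩ := hgen y.2
  exact ⟨⟨x, hx⟩, Subtype.ext hxy⟩
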